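/- Let $\mathcal V$ be a finite or countably infinite set (with the $\sigma$-algebra of all its subsets), and let $k\ge 1$. A *$k$-distinguishing class* on $\mathcal V$ is a set $\mathcal G$ of functions $g:\mathcal V^k\to\{0,1\}$ (indicators of $k$-hypergraphs) that are symmetric, i.e. $g(v_{\pi(1)},\dots,v_{\pi(k)})=g(v_1,\dots,v_k)$ for every permutation $\pi$ of $\{1,\dots,k\}$. For $v\in\mathcal V$ and $k>1$ put $g_v(u_1,\dots,u_{k-1})=g(v,u_1,\dots,u_{k-1})$ and $\mathcal G_v=\{g_v: g\in\mathcal G\}$. The *graph VC dimension* $\mathrm{gVC}(\mathcal G)\in\mathbb N\cup\{\infty\}$ is defined inductively: for $k=1$ it is the usual VC dimension of $\mathcal G$ (the supremum of the sizes of finite sets shattered by $\mathcal G$), and for $k>1$ it is $\sup_{v\in\mathcal V}\mathrm{gVC}(\mathcal G_v)$. For a probability distribution $P$ on $\mathcal V$ and a sample $S=(v_1,\dots,v_m)\in\mathcal V^m$ with $m\geq 1$, let $$L_P(g)=P^k\big(\{(u_1,\dots,u_k): g(u_1,\dots,u_k)=1\}\big),\qquad L_S(g)=\frac1{m^k}\sum_{(i_1,\dots,i_k)\in\{1,\dots,m\}^k}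 g(v_{i_1},\dots,v_{i_k}).$$ **Theorem (uniform convergence).** There is a universal constant $C>0$ such that the following holds for all $\mathcal V$ and $k\ge1$ as above, every $k$-distinguishing class $\mathcal G$ on $\mathcal V$ with $\mathrm{gVC}(\mathcal G)=\rho<\infty$, every probability distribution $P$ on $\mathcal V$, all $\varepsilon>0$ and $0<\delta<1$, and every $m\in\mathbb N$ with $$m\ \ge\ C\,\frac{\max(\rho,1)\,k^2}{\varepsilon^2}\,\log\frac{2}{\delta}:$$ if $S=(v_1,\dots,v_m)$ is an i.i.d. sample drawn from $P$, then with probability at least $1-\delta$ over $S$, $$\sup_{g\in\mathcal G}\big|L_S(g)-L_P(g)\big|\le\varepsilon .$$ (For $\rho\ge1$ and $\delta\le 1/2$ one has $\log(2/\delta)\le 2\log(1/\delta)$, so the condition holds whenever $m\ge 2C\,\rho k^2\varepsilon^{-2}\log(1/\delta)$.) -/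

import Mathlib

open MeasureTheory

universe u

noncomputable section

namespace GraphDiscrimination

/-- A `k`-hypergraph on the vertex set `V`, identified with the indicator function
`V ^ k → {0, 1}` of its set of hyperedges. -/
abbrev Hypergraph (V : Type u) (k : ℕ) : Type u := (Fin k → V) → Bool

/-- The hypergraph `g` is undirected: invariant under permutations of the coordinates. -/
def IsUndirected {V : Type u} {k : ℕ} (g : Hypergraph V k) : Prop :=
  ∀ (π : Equiv.Perm (Fin k)) (v : Fin k → V), g (fun i => v (π i)) = g v

/-- A `k`-distinguishing class: a collection of undirected `k`-hypergraphs on `V`. -/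
def IsDistinguishingClass {V : Type u} {k : ℕ} (G : Set (Hypergraph V k)) : Prop :=
  ∀ g ∈ G, IsUndirected g

/-- The finite set `s` is shattered by `D`: every Boolean function on `s` is the restriction of
a member of `D`. -/
def Shatters {V : Type u} (D : Set (V → Bool)) (s : Finset V) : Prop :=
  ∀ f : V → Bool, ∃ d ∈ D, ∀ x ∈ s, d x = f x

/-- The VC dimension of a class of Boolean functions: the supremum of the sizes of the finite
shattered sets, infinite if these are unbounded. -/
def vcDim {V : Type u} (D : Set (V → Bool)) : ℕ∞ :=
  ⨆ (s : Finset V) (_ : Shatters D s), (s.card : ℕ∞)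

/-- The `1`-hypergraph `g` as a Boolean function on the vertices. -/
def Hypergraph.toBoolFun {V : Type u} (g : Hypergraph V 1) : V → Bool :=
  fun v => g (fun _ => v)

/-- The projected hypergraph `g_v (u₁, …, u_k) = g (v, u₁, …, u_k)`. -/
def Hypergraph.proj {V : Type u} {k : ℕ} (v : V) (g : Hypergraph V (k + 1)) : Hypergraph V k :=
  fun w => g (Fin.cons v w)

/-- The graph VC dimension: the VC dimension for `k = 1`, and the supremum over the vertices `v`
of the graph VC dimension of `G_v = {g_v : g ∈ G}` for `k > 1`. The value at `k = 0`, where the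
notion is not used, is `0`. -/
def gVC {V : Type u} : (k : ℕ) → Set (Hypergraph V k) → ℕ∞
  | 0, _ => 0
  | 1, G => vcDim (Hypergraph.toBoolFun '' G)
  | k + 2, G => ⨆ v : V, gVC (k + 1) (Hypergraph.proj v '' G)

/-- The frequency `L_P(g) = P^k {(v₁, …, v_k) : g (v₁, …, v_k) = 1}` of a hyperedge. -/
def freq {V : Type u} [MeasurableSpace V] {k : ℕ} (P : Measure V) (g : Hypergraph V k) : ℝ :=
  (Measure.pi fun _ : Fin k => P).real {v | g v = true}

/-- The empirical frequency `L_S(g)` of a hyperedge, for a sample `S = (v₁, …, v_m)`: the average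
of `g` over the `m ^ k` tuples `(v_{i₁}, …, v_{i_k})` (repetitions in the sample are counted with
multiplicity). -/
def empFreq {V : Type u} {k m : ℕ} (S : Fin m → V) (g : Hypergraph V k) : ℝ :=
  (1 / (m : ℝ) ^ k) * ∑ i : Fin k → Fin m, if g (fun j => S (i j)) = true then (1 : ℝ) else 0

/-- The uniform deviation `sup_{g ∈ G} |L_S(g) - L_P(g)|` (zero for the empty class; the supremum
is over a bounded set, see `bddAbove_deviation`). -/
def deviation {V : Type u} [MeasurableSpace V] {k m : ℕ} (G : Set (Hypergraph V k))
    (P : Measure V) (S : Fin m → V) : ℝ :=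
  ⨆ g : G, |empFreq S (g : Hypergraph V k) - freq P (g : Hypergraph V k)|

theorem bddAbove_deviation {V : Type u} [MeasurableSpace V] {k m : ℕ} (G : Set (Hypergraph V k))
    (P : Measure V) [IsProbabilityMeasure P] (S : Fin m → V) :
    BddAbove (Set.range fun g : G =>
      |empFreq S (g : Hypergraph V k) - freq P (g : Hypergraph V k)|) := by
  refine ⟨1, ?_⟩
  rintro _ ⟨g, rfl⟩
  have h1 : 0 ≤ freq P (g : Hypergraph V k) := measureReal_nonneg
  have h2 : freq P (g : Hypergraph V k) ≤ 1 := measureReal_le_one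
  have h3 : 0 ≤ empFreq S (g : Hypergraph V k) := by
    unfold empFreq
    refine mul_nonneg (by positivity) (Finset.sum_nonneg fun i _ => ?_)
    split_ifs <;> norm_num
  have h4 : empFreq S (g : Hypergraph V k) ≤ 1 := by
    unfold empFreq
    have hs : (∑ i : Fin k → Fin m,
        if (g : Hypergraph V k) (fun j => S (i j)) = true then (1 : ℝ) else 0) ≤ (m : ℝ) ^ k := by
      refine (Finset.sum_le_sum (g := fun _ => (1 : ℝ)) fun i _ => ?_).trans ?_
      · split_ifs <;> norm_num
      · simp
    rw [one_div, inv_mul_eq_div]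
    exact div_le_one_of_le₀ hs (by positivity)
  exact abs_le.2 ⟨by linarith, by linarith⟩

end GraphDiscrimination

end

/-! Two facts suffice: the deviation concentrates around its mean, and the mean is of order `k * √(D
/ m)` with `D = max ρ 1`. Concentration is McDiarmid's inequality: changing one sample point moves
each empirical frequency, hence the deviation, by at most `k / m`, which gives a Gaussian tail at
scale `k / √m`.

The mean is bounded by induction on `k` (`integral_deviation_le`). The average over the sample of
the true frequencies of the hypergraphs `g_v` is inserted between `L_S(g)` and `L_P(g)`. One
difference is an average of deviations of the classes `G_{S i}`, where the inductive bound applies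
once the vertex `S i` is decoupled from the sample at cost `k / m`. The other is an integral over `u
∈ V^k` of deviations of the slices `v ↦ g(v, u)`. By symmetry of `g`, for each fixed `u` these
slices form a class of VC dimension at most the graph VC dimension, so each level of the induction
adds one ordinary VC deviation.

To avoid a logarithmic factor, that VC deviation must be `O(√(d / m))`. Symmetrization bounds it by
a Rademacher average, and chaining bounds the latter: Haussler-type packing numbers in Hamming
distance (`log_card_le_of_separated`) feed a finite maximal inequality at geometrically decreasing
scales, and the resulting series converges. -/

namespace GraphDiscrimination

/-! ### VC dimension, traces and the Sauer–Shelah bound -/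

/-- Every finite set shattered by `D` has at most `d` elements. -/
def VCDimLE {V : Type u} (D : Set (V → Bool)) (d : ℕ) : Prop :=
  ∀ s : Finset V, Shatters D s → s.card ≤ d

theorem vcDim_le_iff {V : Type u} {D : Set (V → Bool)} {d : ℕ} :
    vcDim D ≤ (d : ℕ∞) ↔ VCDimLE D d := by
  simp [vcDim, VCDimLE, iSup_le_iff]

theorem VCDimLE.mono {V : Type u} {D D' : Set (V → Bool)} {d : ℕ} (h : VCDimLE D d)
    (hD : D' ⊆ D) : VCDimLE D' d := fun s hs =>
  h s fun f => let ⟨g, hg, hgf⟩ := hs f; ⟨g, hD hg, hgf⟩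

/-- Passing to the trace on a (possibly repeating) family of points does not increase the
VC dimension. -/
theorem VCDimLE.comp {V : Type u} {W : Type*} {D : Set (V → Bool)} {d : ℕ} (h : VCDimLE D d)
    (x : W → V) : VCDimLE ((fun f => f ∘ x) '' D) d := by
  classical
  intro s hs
  -- Two indices with the same image receive the same value from every trace, so they cannot both
  -- lie in a shattered set.
  have hinj : Set.InjOn x s := by
    intro a ha b hb hab
    by_contra hne
    obtain ⟨_, ⟨g, _, rfl⟩, hg⟩ := hs fun w => decide (w = a)
    have h1 := hg a ha
    have h2 := hg b hb
    simp only [Function.comp_apply, hab] at h1 h2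
    rw [h1] at h2
    simp at h2
    exact hne h2.symm
  rw [← Finset.card_image_of_injOn hinj]
  refine h _ fun f => ?_
  obtain ⟨_, ⟨g, hgD, rfl⟩, hg⟩ := hs (f ∘ x)
  refine ⟨g, hgD, fun y hy => ?_⟩
  obtain ⟨w, hw, rfl⟩ := Finset.mem_image.1 hy
  exact hg w hw

/-- The Sauer–Shelah lemma for Boolean functions. -/
theorem card_le_sum_choose {n d : ℕ} (T : Finset (Fin n → Bool))
    (h : VCDimLE (T : Set (Fin n → Bool)) d) :
    T.card ≤ ∑ i ∈ Finset.range (d + 1), n.choose i := by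
  classical
  let φ : (Fin n → Bool) → Finset (Fin n) := fun f => Finset.univ.filter fun j => f j = true
  have hφ : Function.Injective φ := by
    intro f g hfg
    funext j
    have := congrArg (fun s => j ∈ s) hfg
    simp only [φ, Finset.mem_filter, Finset.mem_univ, true_and, eq_iff_iff] at this
    exact Bool.eq_iff_iff.2 this
  rw [← Finset.card_image_of_injective T hφ]
  have hvc : (T.image φ).vcDim ≤ d := by
    refine Finset.sup_le fun s hs => h s fun f => ?_
    obtain ⟨u, hu, hsu⟩ := (Finset.mem_shatterer.1 hs) (Finset.filter_subset (fun j => f j = true) s)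
    obtain ⟨g, hg, rfl⟩ := Finset.mem_image.1 hu
    refine ⟨g, hg, fun j hj => ?_⟩
    have := congrArg (fun s => j ∈ s) hsu
    simp only [φ, Finset.mem_filter, Finset.mem_univ, true_and, eq_iff_iff, Finset.mem_inter, hj]
      at this
    exact Bool.eq_iff_iff.2 this
  calc (T.image φ).card ≤ (T.image φ).shatterer.card := Finset.card_le_card_shatterer _
    _ ≤ ∑ k ∈ Finset.Iic (T.image φ).vcDim, (Fintype.card (Fin n)).choose k :=
        Finset.card_shatterer_le_sum_vcDim
    _ ≤ ∑ i ∈ Finset.range (d + 1), n.choose i := by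
        rw [Fintype.card_fin]
        refine Finset.sum_le_sum_of_subset fun i hi => ?_
        rw [Finset.mem_Iic] at hi
        exact Finset.mem_range.2 (by omega)

/-- Since `x ≤ 1`, `x ^ d ≤ x ^ i` for `i ≤ d`, and the binomial theorem does the rest. The free
parameter `x` replaces the usual `(e n / d) ^ d` and needs no case distinction on `d = 0` or `d >
n`. -/
theorem sum_choose_mul_pow_le (n d : ℕ) {x : ℝ} (hx : 0 < x) (hx1 : x ≤ 1) :
    (∑ i ∈ Finset.range (d + 1), (n.choose i : ℝ)) * x ^ d ≤ (1 + x) ^ n := by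
  have h1 : (1 + x) ^ n = ∑ i ∈ Finset.range (n + 1), x ^ i * (n.choose i : ℝ) := by
    rw [add_comm, add_pow]; simp
  rw [h1, Finset.sum_mul]
  calc ∑ i ∈ Finset.range (d + 1), (n.choose i : ℝ) * x ^ d
      ≤ ∑ i ∈ Finset.range (d + 1), x ^ i * (n.choose i : ℝ) := by
        refine Finset.sum_le_sum fun i hi => ?_
        rw [mul_comm]
        refine mul_le_mul_of_nonneg_right ?_ (by positivity)
        exact pow_le_pow_of_le_one hx.le hx1 (Nat.lt_succ_iff.1 (Finset.mem_range.1 hi))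
    _ ≤ ∑ i ∈ Finset.range (n + 1 + (d + 1)), x ^ i * (n.choose i : ℝ) := by
        refine Finset.sum_le_sum_of_subset_of_nonneg (fun i hi => ?_) fun i _ _ => by positivity
        rw [Finset.mem_range] at hi ⊢; omega
    _ = ∑ i ∈ Finset.range (n + 1), x ^ i * (n.choose i : ℝ) := by
        symm
        refine Finset.sum_subset (fun i hi => ?_) fun i _ hi => ?_
        · rw [Finset.mem_range] at hi ⊢; omega
        · rw [Nat.choose_eq_zero_of_lt (by rw [Finset.mem_range] at hi; omega)]; simp

/-! ### Packing numbers in Hamming distance -/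

/-- The number of `n`-tuples of coordinates on which two separated vectors agree. -/
theorem card_agree_le {m : ℕ} (n : ℕ) {ε : ℝ} (f g : Fin m → Bool)
    (h : ε * m ≤ hammingDist f g) :
    (((Finset.univ : Finset (Fin n → Fin m)).filter fun t => f ∘ t = g ∘ t).card : ℝ)
      ≤ (m : ℝ) ^ n * Real.exp (-(ε * n)) := by
  classical
  have h1 : ((Finset.univ : Finset (Fin n → Fin m)).filter fun t => f ∘ t = g ∘ t)
      = Fintype.piFinset fun _ : Fin n => Finset.univ.filter fun j => f j = g j := by
    ext t; simp [funext_iff, Fintype.mem_piFinset]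
  have h2 : (Finset.univ.filter fun j => f j = g j).card + hammingDist f g = m := by
    have := Finset.card_filter_add_card_filter_not (s := (Finset.univ : Finset (Fin m)))
      (fun j => f j = g j)
    simpa [hammingDist] using this
  have h3 : ((Finset.univ.filter fun j => f j = g j).card : ℝ) ≤ m * Real.exp (-ε) := by
    have h4 : ((Finset.univ.filter fun j => f j = g j).card : ℝ) + hammingDist f g = m := by
      exact_mod_cast h2
    have h5 := Real.add_one_le_exp (-ε)
    nlinarith [(Nat.cast_nonneg m : (0 : ℝ) ≤ m)]
  rw [h1, Fintype.card_piFinset_const]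
  push_cast
  calc _ ≤ (m * Real.exp (-ε)) ^ n := pow_le_pow_left₀ (by positivity) h3 n
    _ = _ := by rw [mul_pow, ← Real.exp_nat_mul]; ring_nf

/-- Packing numbers of classes of bounded VC dimension in the normalized Hamming distance. -/
theorem log_card_le_of_separated {m d : ℕ} (hm : 0 < m) (T : Finset (Fin m → Bool))
    (h : VCDimLE (T : Set (Fin m → Bool)) d) (hT : T.Nonempty) {ε : ℝ} (hε : 0 < ε) (hε1 : ε ≤ 1)
    (hsep : ∀ f ∈ T, ∀ g ∈ T, f ≠ g → ε * m ≤ hammingDist f g) :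
    Real.log T.card ≤ 4 / 3 * (1 / 8 + d * Real.log (8 / ε)) := by
  classical
  set L := Real.log T.card with hL
  have hN : (0 : ℝ) < T.card := by exact_mod_cast hT.card_pos
  have hL0 : 0 ≤ L := Real.log_natCast_nonneg _
  -- The least `n` with `ε n > 2 L`: a union bound over fewer than `exp (2 L)` pairs, each failing
  -- with probability at most `exp (-ε n)`, then succeeds.
  set n : ℕ := ⌊2 * L / ε⌋₊ + 1 with hn
  have hn1 : 2 * L < ε * n := by
    have := Nat.lt_floor_add_one (2 * L / ε)
    rw [div_lt_iff₀ hε] at this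
    rw [hn]; push_cast; linarith
  have hn2 : ε * n ≤ 2 * L + ε := by
    have := Nat.floor_le (show 0 ≤ 2 * L / ε by positivity)
    rw [le_div_iff₀ hε] at this
    rw [hn]; push_cast; linarith
  -- Probabilistic method: some `n`-tuple of coordinates distinguishes all members of `T`, so
  -- Sauer–Shelah can be applied on `n` points instead of `m`.
  obtain ⟨t, ht⟩ : ∃ t : Fin n → Fin m, ∀ f ∈ T, ∀ g ∈ T, f ∘ t = g ∘ t → f = g := by
    by_contra hcon
    push Not at hcon
    have hsub : (Finset.univ : Finset (Fin n → Fin m)) ⊆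
        T.offDiag.biUnion fun p => Finset.univ.filter fun t => p.1 ∘ t = p.2 ∘ t := by
      intro t _
      obtain ⟨f, hf, g, hg, h1, h2⟩ := hcon t
      rw [Finset.mem_biUnion]
      exact ⟨(f, g), Finset.mem_offDiag.2 ⟨hf, hg, h2⟩, by simpa using h1⟩
    have h1 : ((m : ℝ) ^ n) ≤ ∑ p ∈ T.offDiag, (m : ℝ) ^ n * Real.exp (-(ε * n)) := by
      have h2 := (Finset.card_le_card hsub).trans Finset.card_biUnion_le
      have h3 : ((Finset.univ : Finset (Fin n → Fin m)).card : ℝ) = (m : ℝ) ^ n := by simp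
      rw [← h3]
      calc _ ≤ ((∑ p ∈ T.offDiag, (Finset.univ.filter
              fun t : Fin n → Fin m => p.1 ∘ t = p.2 ∘ t).card : ℕ) : ℝ) := by exact_mod_cast h2
        _ ≤ _ := by
          push_cast
          rw [h3]
          refine Finset.sum_le_sum fun p hp => card_agree_le n _ _ ?_
          rw [Finset.mem_offDiag] at hp
          exact hsep _ hp.1 _ hp.2.1 hp.2.2
    have hmn : (0 : ℝ) < (m : ℝ) ^ n := by positivity
    rw [Finset.sum_const, nsmul_eq_mul] at h1
    have h4 : (T.offDiag.card : ℝ) ≤ Real.exp (2 * L) := by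
      have : (T.offDiag.card : ℝ) ≤ T.card * T.card := by
        rw [Finset.offDiag_card]; exact_mod_cast Nat.sub_le _ _
      rw [two_mul, Real.exp_add, hL, Real.exp_log hN]
      exact this
    have h5 : (T.offDiag.card : ℝ) * Real.exp (-(ε * n)) < 1 := by
      calc _ ≤ Real.exp (2 * L) * Real.exp (-(ε * n)) :=
            mul_le_mul_of_nonneg_right h4 (Real.exp_pos _).le
        _ = Real.exp (2 * L - ε * n) := by rw [← Real.exp_add]; ring_nf
        _ < 1 := by rw [Real.exp_lt_one_iff]; linarith
    nlinarith
  have hcard : T.card ≤ ∑ i ∈ Finset.range (d + 1), n.choose i := by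
    rw [← Finset.card_image_of_injOn (f := fun f => f ∘ t) (s := T)
      (fun f hf g hg hfg => ht f hf g hg hfg)]
    refine card_le_sum_choose _ ?_
    rw [Finset.coe_image]
    exact h.comp t
  -- With `x = ε / 8` the exponent satisfies `ε n / 8 ≤ L / 4 + 1 / 8`; the term `L / 4` is absorbed
  -- on the left, whence the factor `4 / 3`.
  have hx : 0 < ε / 8 := by positivity
  have h1 : (T.card : ℝ) * (ε / 8) ^ d ≤ Real.exp (ε / 8 * n) := by
    calc (T.card : ℝ) * (ε / 8) ^ d
        ≤ (∑ i ∈ Finset.range (d + 1), (n.choose i : ℝ)) * (ε / 8) ^ d :=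
          mul_le_mul_of_nonneg_right (by exact_mod_cast hcard) (by positivity)
      _ ≤ (1 + ε / 8) ^ n := sum_choose_mul_pow_le n d hx (by linarith)
      _ ≤ (Real.exp (ε / 8)) ^ n :=
          pow_le_pow_left₀ (by positivity) (by linarith [Real.add_one_le_exp (ε / 8)]) n
      _ = _ := by rw [← Real.exp_nat_mul]; ring_nf
  have h2 := Real.log_le_log (by positivity) h1
  rw [Real.log_exp, Real.log_mul hN.ne' (by positivity), Real.log_pow, ← hL] at h2
  have h3 : Real.log (8 / ε) = - Real.log (ε / 8) := by rw [← Real.log_inv, inv_div]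
  rw [h3]
  linarith

/-! ### Rademacher sums and chaining -/

/-- The indicator of a Boolean as a real number. -/
noncomputable def ind (b : Bool) : ℝ := if b = true then 1 else 0

/-- The Rademacher sign of a Boolean. -/
noncomputable def sgn (b : Bool) : ℝ := if b = true then 1 else -1

/-- The sum over signs factors over coordinates, and `cosh x ≤ exp (x ^ 2 / 2)` bounds each factor.
-/
theorem sum_exp_rademacher_le {m : ℕ} (a : Fin m → ℝ) (l : ℝ) :
    ∑ σ : Fin m → Bool, Real.exp (l * ∑ j, sgn (σ j) * a j)
      ≤ 2 ^ m * Real.exp (l ^ 2 * (∑ j, a j ^ 2) / 2) := by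
  classical
  have h1 : ∀ σ : Fin m → Bool, Real.exp (l * ∑ j, sgn (σ j) * a j)
      = ∏ j, Real.exp (sgn (σ j) * (l * a j)) := fun σ => by
    rw [← Real.exp_sum, Finset.mul_sum]; congr 1
    exact Finset.sum_congr rfl fun j _ => by ring
  simp_rw [h1]
  rw [← Fintype.prod_sum (fun (j : Fin m) (b : Bool) => Real.exp (sgn b * (l * a j)))]
  have h2 : ∀ j, ∑ b : Bool, Real.exp (sgn b * (l * a j)) ≤ 2 * Real.exp ((l * a j) ^ 2 / 2) := by
    intro j
    have := Real.cosh_le_exp_half_sq (l * a j)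
    rw [Real.cosh_eq] at this
    simp only [Fintype.sum_bool, sgn]
    simp
    linarith
  refine (Finset.prod_le_prod (fun j _ => Finset.sum_nonneg fun b _ => (Real.exp_pos _).le)
    fun j _ => h2 j).trans ?_
  rw [Finset.prod_mul_distrib, ← Real.exp_sum]
  simp only [Finset.prod_const, Finset.card_univ, Fintype.card_fin]
  refine mul_le_mul_of_nonneg_left (le_of_eq ?_) (by positivity)
  congr 1
  rw [Finset.mul_sum, Finset.sum_div]
  exact Finset.sum_congr rfl fun j _ => by ring

/-- The maximal inequality for finitely many Rademacher sums. -/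
theorem sum_rademacher_max_le {m : ℕ} {ι : Type*} (A : Finset ι) (a : ι → Fin m → ℝ) {v l : ℝ}
    (hl : 0 < l) (hv : ∀ i ∈ A, ∑ j, a i j ^ 2 ≤ v) (Y : (Fin m → Bool) → ℝ)
    (hY : ∀ σ, ∃ i ∈ A, Y σ ≤ |∑ j, sgn (σ j) * a i j|) :
    ∑ σ, Y σ ≤ 2 ^ m * (Real.log (2 * A.card) / l + l * v / 2) := by
  classical
  have hA : A.Nonempty := let ⟨i, hi, _⟩ := hY fun _ => true; ⟨i, hi⟩
  have hN : (0 : ℝ) < 2 * A.card := by have := hA.card_pos; positivity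
  set c := Real.log (2 * A.card) + l ^ 2 * v / 2 with hc
  -- The tangent bound `y ≤ c - 1 + exp (y - c)` replaces Jensen's inequality; `c` is the logarithm
  -- of the bound on the averaged exponentials.
  have h1 : ∀ σ, l * Y σ ≤ c - 1 + Real.exp (-c) * ∑ i ∈ A,
      (Real.exp (l * ∑ j, sgn (σ j) * a i j) + Real.exp (-l * ∑ j, sgn (σ j) * a i j)) := by
    intro σ
    obtain ⟨i, hi, hYi⟩ := hY σ
    have h2 := Real.add_one_le_exp (l * Y σ - c)
    have h3 : Real.exp (l * Y σ) ≤ Real.exp (l * ∑ j, sgn (σ j) * a i j)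
        + Real.exp (-l * ∑ j, sgn (σ j) * a i j) := by
      rcases le_total 0 (∑ j, sgn (σ j) * a i j) with h | h
      · rw [abs_of_nonneg h] at hYi
        have := Real.exp_le_exp.2 (mul_le_mul_of_nonneg_left hYi hl.le)
        linarith [Real.exp_pos (-l * ∑ j, sgn (σ j) * a i j)]
      · rw [abs_of_nonpos h] at hYi
        have := Real.exp_le_exp.2 (mul_le_mul_of_nonneg_left hYi hl.le)
        rw [mul_neg, ← neg_mul] at this
        linarith [Real.exp_pos (l * ∑ j, sgn (σ j) * a i j)]
    have h4 := Finset.single_le_sum (f := fun i => Real.exp (l * ∑ j, sgn (σ j) * a i j)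
        + Real.exp (-l * ∑ j, sgn (σ j) * a i j)) (fun i _ => by positivity) hi
    have h5 := mul_le_mul_of_nonneg_left (h3.trans h4) (Real.exp_pos (-c)).le
    have h6 : Real.exp (l * Y σ - c) = Real.exp (-c) * Real.exp (l * Y σ) := by
      rw [← Real.exp_add]; ring_nf
    linarith
  have h2 : ∑ σ : Fin m → Bool, ∑ i ∈ A, (Real.exp (l * ∑ j, sgn (σ j) * a i j)
      + Real.exp (-l * ∑ j, sgn (σ j) * a i j)) ≤ 2 ^ m * Real.exp c := by
    rw [Finset.sum_comm]
    have h3 : ∀ i ∈ A, ∑ σ : Fin m → Bool, (Real.exp (l * ∑ j, sgn (σ j) * a i j)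
        + Real.exp (-l * ∑ j, sgn (σ j) * a i j)) ≤ 2 ^ m * (2 * Real.exp (l ^ 2 * v / 2)) := by
      intro i hi
      rw [Finset.sum_add_distrib]
      have h4 := sum_exp_rademacher_le (a i) l
      have h5 := sum_exp_rademacher_le (a i) (-l)
      rw [neg_sq] at h5
      have h6 : Real.exp (l ^ 2 * (∑ j, a i j ^ 2) / 2) ≤ Real.exp (l ^ 2 * v / 2) := by
        have := hv i hi
        gcongr
      have h7 := mul_le_mul_of_nonneg_left h6 (show (0 : ℝ) ≤ 2 ^ m by positivity)
      linarith
    refine (Finset.sum_le_sum h3).trans (le_of_eq ?_)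
    rw [Finset.sum_const, nsmul_eq_mul, hc, Real.exp_add, Real.exp_log hN]
    ring
  have h3 : l * ∑ σ, Y σ ≤ 2 ^ m * c := by
    rw [Finset.mul_sum]
    refine (Finset.sum_le_sum fun σ _ => h1 σ).trans ?_
    rw [Finset.sum_add_distrib, ← Finset.mul_sum]
    have h4 := mul_le_mul_of_nonneg_left h2 (Real.exp_pos (-c)).le
    have h5 : Real.exp (-c) * (2 ^ m * Real.exp c) = 2 ^ m := by
      rw [Real.exp_neg]; field_simp
    have h6 : ∑ _σ : Fin m → Bool, (c - 1) = 2 ^ m * (c - 1) := by simp; ring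
    linarith
  rw [← le_div_iff₀' hl] at h3
  refine h3.trans (le_of_eq ?_)
  rw [hc]; field_simp

/-- A separated subset of maximal size is a net, since an uncovered point could be added to it. The
alternative `f = g` covers `r ≤ 0`. -/
theorem exists_separated_net {m : ℕ} (T : Finset (Fin m → Bool)) (r : ℝ) :
    ∃ N ⊆ T, (∀ f ∈ N, ∀ g ∈ N, f ≠ g → r ≤ hammingDist f g) ∧
      ∀ f ∈ T, ∃ g ∈ N, f = g ∨ (hammingDist f g : ℝ) < r := by
  classical
  obtain ⟨N, hN, hmax⟩ := Finset.exists_max_image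
    (T.powerset.filter fun N => ∀ f ∈ N, ∀ g ∈ N, f ≠ g → r ≤ hammingDist f g) Finset.card
    ⟨∅, by simp⟩
  simp only [Finset.mem_filter, Finset.mem_powerset] at hN hmax
  refine ⟨N, hN.1, hN.2, fun f hf => ?_⟩
  by_contra! hcon
  have hfN : f ∉ N := fun h => (hcon f h).1 rfl
  have h1 := hmax (insert f N) ⟨Finset.insert_subset hf hN.1, fun a ha b hb hab => by
    rcases Finset.mem_insert.1 ha with ha' | ha'
    · rcases Finset.mem_insert.1 hb with hb' | hb'
      · exact absurd (ha'.trans hb'.symm) hab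
      · rw [ha']; exact (hcon b hb').2
    · rcases Finset.mem_insert.1 hb with hb' | hb'
      · rw [hb', hammingDist_comm]; exact (hcon a ha').2
      · exact hN.2 a ha' b hb' hab⟩
  rw [Finset.card_insert_of_notMem hfN] at h1
  omega

theorem sum_sq_ind_sub {m : ℕ} (f g : Fin m → Bool) :
    ∑ j, (ind (f j) - ind (g j)) ^ 2 = hammingDist f g := by
  classical
  rw [hammingDist, Finset.card_filter]
  push_cast
  refine Finset.sum_congr rfl fun j _ => ?_
  cases f j <;> cases g j <;> simp [ind]

theorem sum_chain_weights_le (J : ℕ) :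
    ∑ j ∈ Finset.range J, (10 + 4 * (j : ℝ)) / 2 ^ j ≤ 28 := by
  have h : ∑ j ∈ Finset.range J, (10 + 4 * (j : ℝ)) / 2 ^ j = 28 - (28 + 8 * J) / 2 ^ J := by
    induction J with
    | zero => simp
    | succ J ih => rw [Finset.sum_range_succ, ih]; push_cast; field_simp; ring
  rw [h]
  have : (0 : ℝ) ≤ (28 + 8 * J) / 2 ^ J := by positivity
  linarith

/-- Chaining: the Rademacher complexity of a class of VC dimension at most `d`. -/
theorem sum_rademacher_vc_le {m d : ℕ} (hm : 0 < m) (T : Finset (Fin m → Bool))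
    (h : VCDimLE (T : Set (Fin m → Bool)) d) (Y : (Fin m → Bool) → ℝ)
    (hY : ∀ σ, ∃ f ∈ T, Y σ ≤ |∑ j, sgn (σ j) * ind (f j)|) :
    ∑ σ, Y σ ≤ 2 ^ m * (33 * (√((max d 1 : ℕ) / m) * m)) := by
  classical
  have hT : T.Nonempty := let ⟨f, hf, _⟩ := hY fun _ => true; ⟨f, hf⟩
  set D : ℝ := ((max d 1 : ℕ) : ℝ) with hD
  have hD1 : 1 ≤ D := by rw [hD]; exact_mod_cast le_max_right d 1
  have hdD : (d : ℝ) ≤ D := by rw [hD]; exact_mod_cast le_max_left d 1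
  have hm' : (0 : ℝ) < m := by exact_mod_cast hm
  set s := √(D / m) with hs
  have hs0 : 0 < s := Real.sqrt_pos.2 (by positivity)
  have hsD : D = s * s * m := by
    rw [hs, Real.mul_self_sqrt (by positivity)]; field_simp
  -- Hamming distance is squared Euclidean distance, so radius `4 ^ (-j) * m` is scale `2 ^ (-j)` in
  -- normalized `L²`.
  choose N hNT hNsep hNcov using fun j : ℕ => exists_separated_net T ((4 ^ j)⁻¹ * m)
  have hNne : ∀ j, (N j).Nonempty := fun j =>
    let ⟨f, hf⟩ := hT; let ⟨g, hg, _⟩ := hNcov j f hf; ⟨g, hg⟩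
  -- Here `8 * 4 ^ j = 2 ^ (3 + 2 * j)` and `4 / 3 * log 2 < 1`; the slack, with `D ≥ 1`, absorbs
  -- the additive `1 / 6`.
  have hlog : ∀ j : ℕ, Real.log (N j).card ≤ D * (3 + 2 * j) := by
    intro j
    have h1 := log_card_le_of_separated hm (N j) (h.mono (by exact_mod_cast hNT j)) (hNne j)
      (show (0 : ℝ) < (4 ^ j)⁻¹ by positivity)
      (inv_le_one_of_one_le₀ (one_le_pow₀ (by norm_num))) (hNsep j)
    have h2 : Real.log (8 / (4 ^ j)⁻¹) = (3 + 2 * j) * Real.log 2 := by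
      have : (8 / (4 ^ j)⁻¹ : ℝ) = 2 ^ (3 + 2 * j) := by
        rw [pow_add, pow_mul]; norm_num
      rw [this, Real.log_pow]; push_cast; ring
    rw [h2] at h1
    have h3 := Real.log_two_lt_d9
    have h4 : (d : ℝ) * ((3 + 2 * j) * Real.log 2) ≤ D * ((3 + 2 * j) * 0.6932) := by
      refine mul_le_mul hdD ?_ (mul_nonneg (by positivity) (Real.log_nonneg (by norm_num)))
        (by linarith)
      exact mul_le_mul_of_nonneg_left (by linarith) (by positivity)
    have h5 : 0 ≤ D * j := by positivity
    nlinarith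
  choose p hpN hp using hNcov
  choose F hFT hF using hY
  set q : ℕ → (Fin m → Bool) → (Fin m → Bool) := fun j σ => p j (F σ) (hFT σ) with hq
  have hqdist : ∀ j σ, (hammingDist (F σ) (q j σ) : ℝ) ≤ (4 ^ j)⁻¹ * m := by
    intro j σ
    rcases hp j (F σ) (hFT σ) with h1 | h1
    · have : hammingDist (F σ) (q j σ) = 0 := hammingDist_eq_zero.2 h1
      rw [this]; simp
    · exact h1.le
  -- The chain is finite: at level `m` the radius is at most `1`, and Hamming distances are
  -- integers.
  have hqm : ∀ σ, q m σ = F σ := by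
    intro σ
    rcases hp m (F σ) (hFT σ) with h1 | h1
    · exact h1.symm
    · have h2 : ((4 : ℝ) ^ m)⁻¹ * m ≤ 1 := by
        rw [inv_mul_le_iff₀ (by positivity), mul_one]
        exact_mod_cast (Nat.lt_pow_self (by norm_num : 1 < 4)).le
      have h3 : hammingDist (F σ) (q m σ) < 1 := by exact_mod_cast h1.trans_le h2
      exact (hammingDist_eq_zero.1 (Nat.lt_one_iff.1 h3)).symm
  have hYsum : ∀ σ, Y σ ≤ |∑ i, sgn (σ i) * ind (q 0 σ i)| + ∑ j ∈ Finset.range m,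
      |∑ i, sgn (σ i) * (ind (q (j + 1) σ i) - ind (q j σ i))| := by
    intro σ
    have h1 : ∑ i, sgn (σ i) * ind (F σ i) = ∑ i, sgn (σ i) * ind (q 0 σ i)
        + ∑ j ∈ Finset.range m, ∑ i, sgn (σ i) * (ind (q (j + 1) σ i) - ind (q j σ i)) := by
      rw [← hqm σ, Finset.sum_comm, ← Finset.sum_add_distrib]
      refine Finset.sum_congr rfl fun i _ => ?_
      rw [← Finset.mul_sum, Finset.sum_range_sub (fun j => ind (q j σ i))]
      simp only [hqm]
      ring
    refine (hF σ).trans ?_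
    rw [h1]
    exact (abs_add_le _ _).trans (add_le_add le_rfl (Finset.abs_sum_le_sum_abs _ _))
  have hbase : ∑ σ : Fin m → Bool, |∑ i, sgn (σ i) * ind (q 0 σ i)|
      ≤ 2 ^ m * (5 * (s * m)) := by
    refine (sum_rademacher_max_le (N 0) (fun f i => ind (f i)) (v := m) hs0 (fun f _ => ?_) _
      fun σ => ⟨q 0 σ, hpN 0 _ _, le_rfl⟩).trans ?_
    · refine (Finset.sum_le_sum (g := fun _ => (1 : ℝ)) fun i _ => ?_).trans (by simp)
      cases f i <;> simp [ind]
    · refine mul_le_mul_of_nonneg_left ?_ (by positivity)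
      have hc : (0 : ℝ) < (N 0).card := by exact_mod_cast (hNne 0).card_pos
      have h1 : Real.log (2 * (N 0).card) / s ≤ 4 * (s * m) := by
        rw [div_le_iff₀ hs0, Real.log_mul (by norm_num) hc.ne']
        have := hlog 0
        have := Real.log_two_lt_d9
        push_cast at *
        nlinarith
      have : 0 ≤ s * m := by positivity
      linarith
  have hstep : ∀ j : ℕ, ∑ σ : Fin m → Bool,
      |∑ i, sgn (σ i) * (ind (q (j + 1) σ i) - ind (q j σ i))|
      ≤ 2 ^ m * ((10 + 4 * j) / 2 ^ j * (s * m)) := by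
    intro j
    -- For this parameter both terms of the maximal inequality, entropy over `l` and `l` times
    -- variance, are of order `s * m / 2 ^ j`, up to a factor linear in `j`.
    have hl : 0 < s * 2 ^ j := by positivity
    -- Only pairs that can be consecutive links are kept; both lie near `F σ`, so their distance is
    -- at most `(1 / 4 + 1) * 4 ^ (-j) * m`.
    set A := (N (j + 1) ×ˢ N j).filter
      fun x => (hammingDist x.1 x.2 : ℝ) ≤ 5 / 4 * (4 ^ j)⁻¹ * m with hA
    have hmem : ∀ σ, (q (j + 1) σ, q j σ) ∈ A := by
      intro σ
      simp only [hA, Finset.mem_filter, Finset.mem_product]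
      refine ⟨⟨hpN _ _ _, hpN _ _ _⟩, ?_⟩
      have h1 := hqdist (j + 1) σ
      have h2 := hqdist j σ
      have h3 : (hammingDist (q (j + 1) σ) (q j σ) : ℝ)
          ≤ hammingDist (F σ) (q (j + 1) σ) + hammingDist (F σ) (q j σ) := by
        rw [hammingDist_comm (F σ) (q (j + 1) σ)]
        exact_mod_cast hammingDist_triangle _ _ _
      rw [pow_succ, mul_inv] at h1
      linarith
    have hAc : (0 : ℝ) < A.card := by
      exact_mod_cast Finset.card_pos.2 ⟨_, hmem fun _ => true⟩
    have hlogA : Real.log (2 * A.card) ≤ D * (9 + 4 * j) := by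
      have h1 : A.card ≤ (N (j + 1)).card * (N j).card := by
        rw [← Finset.card_product]; exact Finset.card_filter_le _ _
      have h2 : (0 : ℝ) < (N (j + 1)).card := by exact_mod_cast (hNne _).card_pos
      have h3 : (0 : ℝ) < (N j).card := by exact_mod_cast (hNne _).card_pos
      have h4 := Real.log_le_log hAc (show (A.card : ℝ) ≤ (N (j + 1)).card * (N j).card by
        exact_mod_cast h1)
      rw [Real.log_mul h2.ne' h3.ne'] at h4
      rw [Real.log_mul (by norm_num) hAc.ne']
      have h5 := hlog (j + 1)
      have h6 := hlog j
      have := Real.log_two_lt_d9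
      push_cast at *
      linarith
    refine (sum_rademacher_max_le A (fun x i => ind (x.1 i) - ind (x.2 i))
      (v := 5 / 4 * (4 ^ j)⁻¹ * m) hl (fun x hx => ?_) _
      fun σ => ⟨_, hmem σ, le_rfl⟩).trans ?_
    · rw [sum_sq_ind_sub]
      exact (Finset.mem_filter.1 hx).2
    · refine mul_le_mul_of_nonneg_left ?_ (by positivity)
      have h1 : Real.log (2 * A.card) / (s * 2 ^ j) ≤ (9 + 4 * j) / 2 ^ j * (s * m) := by
        rw [div_le_iff₀ hl]
        refine hlogA.trans (le_of_eq ?_)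
        rw [hsD]; field_simp
      have h2 : s * 2 ^ j * (5 / 4 * (4 ^ j)⁻¹ * m) / 2 = 5 / 8 / 2 ^ j * (s * m) := by
        rw [show (4 : ℝ) ^ j = 2 ^ j * 2 ^ j by rw [← mul_pow]; norm_num]
        field_simp; norm_num
      have h3 : (10 + 4 * (j : ℝ)) / 2 ^ j * (s * m)
          = (9 + 4 * j) / 2 ^ j * (s * m) + 1 / 2 ^ j * (s * m) := by ring
      have h4 : 5 / 8 / 2 ^ j * (s * m) ≤ 1 / 2 ^ j * (s * m) := by gcongr; norm_num
      linarith
  calc ∑ σ, Y σ ≤ ∑ σ : Fin m → Bool, (|∑ i, sgn (σ i) * ind (q 0 σ i)| + ∑ j ∈ Finset.range m,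
      |∑ i, sgn (σ i) * (ind (q (j + 1) σ i) - ind (q j σ i))|) :=
        Finset.sum_le_sum fun σ _ => hYsum σ
    _ ≤ 2 ^ m * (5 * (s * m)) + ∑ j ∈ Finset.range m,
        2 ^ m * ((10 + 4 * j) / 2 ^ j * (s * m)) := by
        rw [Finset.sum_add_distrib, Finset.sum_comm]
        exact add_le_add hbase (Finset.sum_le_sum fun j _ => hstep j)
    _ ≤ 2 ^ m * (33 * (s * m)) := by
        rw [← Finset.mul_sum, ← Finset.sum_mul, ← mul_add, ← add_mul]
        have := sum_chain_weights_le m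
        gcongr
        linarith

/-! ### Bounded functions, suprema and integrals over samples -/

theorem integrable_of_abs_le {Ω : Type*} [MeasurableSpace Ω] [DiscreteMeasurableSpace Ω]
    (μ : Measure Ω) [IsFiniteMeasure μ] (f : Ω → ℝ) {M : ℝ} (hM : ∀ x, |f x| ≤ M) :
    Integrable f μ :=
  Integrable.of_bound (Measurable.of_discrete (f := f)).aestronglyMeasurable M
    (Filter.Eventually.of_forall hM)

theorem abs_integral_le {Ω : Type*} [MeasurableSpace Ω] (μ : Measure Ω) [IsProbabilityMeasure μ]
    (f : Ω → ℝ) {M : ℝ} (hM : ∀ x, |f x| ≤ M) : |∫ x, f x ∂μ| ≤ M := by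
  have := norm_integral_le_of_norm_le_const (μ := μ) (f := f) (Filter.Eventually.of_forall hM)
  simpa using this

theorem ciSup_abs_nonneg {ι : Type*} (f : ι → ℝ) : 0 ≤ ⨆ i, |f i| :=
  Real.iSup_nonneg fun _ => abs_nonneg _

theorem abs_ciSup_abs_le {ι : Type*} (f : ι → ℝ) {M : ℝ} (hM0 : 0 ≤ M) (hM : ∀ i, |f i| ≤ M) :
    |(⨆ i, |f i|)| ≤ M := by
  rw [abs_of_nonneg (ciSup_abs_nonneg f)]
  exact Real.iSup_le hM hM0

theorem le_ciSup_abs {ι : Type*} (f : ι → ℝ) {M : ℝ} (hM : ∀ i, |f i| ≤ M) (i : ι) :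
    |f i| ≤ ⨆ i, |f i| :=
  le_ciSup (f := fun i => |f i|) ⟨M, by rintro _ ⟨j, rfl⟩; exact hM j⟩ i

/-- Exchange the coordinates of two samples where `σ` is false. -/
def swapSamples {V : Type u} {m : ℕ} (σ : Fin m → Bool) (x : (Fin m → V) × (Fin m → V)) :
    (Fin m → V) × (Fin m → V) :=
  (fun j => if σ j then x.1 j else x.2 j, fun j => if σ j then x.2 j else x.1 j)

theorem swapSamples_involutive {V : Type u} {m : ℕ} (σ : Fin m → Bool) :
    Function.Involutive (swapSamples (V := V) σ) := by
  intro x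
  refine Prod.ext (funext fun j => ?_) (funext fun j => ?_) <;>
  · simp only [swapSamples]; cases σ j <;> simp

/-- On a fixed sample even an infinite class has finitely many traces, so the supremum is attained
and the chaining bound for finite sets applies. -/
theorem sum_ciSup_rademacher_le {V : Type u} {m d : ℕ} (hm : 0 < m) {ι : Type*} [Nonempty ι] (a : ι → V → Bool)
    (ha : VCDimLE (Set.range a) d) (S : Fin m → V) :
    ∑ σ : Fin m → Bool, ⨆ i, |∑ j, sgn (σ j) * ind (a i (S j))|
      ≤ 2 ^ m * (33 * (√((max d 1 : ℕ) / m) * m)) := by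
  classical
  have hfin : (Set.range fun i => a i ∘ S).Finite := Set.toFinite _
  refine sum_rademacher_vc_le hm hfin.toFinset ?_ _ fun σ => ?_
  · rw [Set.Finite.coe_toFinset]
    have := ha.comp S
    rwa [← Set.range_comp] at this
  · have hfin2 : (Set.range fun i => |∑ j, sgn (σ j) * ind (a i (S j))|).Finite := by
      refine (hfin.image fun f => |∑ j, sgn (σ j) * ind (f j)|).subset ?_
      rintro _ ⟨i, rfl⟩
      exact ⟨_, ⟨i, rfl⟩, rfl⟩
    obtain ⟨i, hi⟩ := (Set.range_nonempty _).csSup_mem hfin2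
    exact ⟨a i ∘ S, by simp, hi.ge⟩

/-! ### Bounded differences and McDiarmid's inequality -/

/-- Hoeffding's lemma on the interval of length `2 * c` around one value of `g`; this costs a factor
`4` in the exponent against the optimal `l ^ 2 * c ^ 2 / 8`. -/
theorem integral_exp_sub_le_of_abs_sub_le {V : Type u} [MeasurableSpace V] [DiscreteMeasurableSpace V]
    (P : Measure V) [IsProbabilityMeasure P] (g : V → ℝ)
    {c : ℝ} (hc : ∀ v w, |g v - g w| ≤ c) (l : ℝ) :
    ∫ v, Real.exp (l * (g v - ∫ w, g w ∂P)) ∂P ≤ Real.exp (l ^ 2 * c ^ 2 / 2) := by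
  obtain ⟨w⟩ : Nonempty V := P.nonempty_of_neZero
  have hc0 : 0 ≤ c := (abs_nonneg _).trans (hc w w)
  have h := ProbabilityTheory.hasSubgaussianMGF_of_mem_Icc (μ := P) (X := g)
    (a := g w - c) (b := g w + c) (Measurable.of_discrete).aemeasurable
    (Filter.Eventually.of_forall fun v => by
      have := abs_le.1 (hc v w)
      exact ⟨by linarith, by linarith⟩)
  have h1 := h.mgf_le l
  rw [ProbabilityTheory.mgf] at h1
  refine h1.trans (le_of_eq ?_)
  congr 1
  push_cast
  rw [show g w + c - (g w - c) = 2 * c by ring, Real.norm_of_nonneg (by linarith)]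
  ring

theorem integral_pi_eval {V : Type u} [MeasurableSpace V] [DiscreteMeasurableSpace V]
    (P : Measure V) [IsProbabilityMeasure P] {m : ℕ} (j : Fin m)
    (f : V → ℝ) : ∫ S, f (S j) ∂(Measure.pi fun _ : Fin m => P) = ∫ v, f v ∂P := by
  have h := measurePreserving_eval (fun _ : Fin m => P) j
  rw [← integral_map (φ := fun S : Fin m → V => S j) (μ := Measure.pi fun _ : Fin m => P) (f := f)
    h.measurable.aemeasurable Measurable.of_discrete.aestronglyMeasurable]
  exact congrArg (fun ν => ∫ v, f v ∂ν) h.map_eq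

section

variable {V : Type u} [Countable V] [MeasurableSpace V] [DiscreteMeasurableSpace V]

theorem integral_pi_insertNth (P : Measure V) [IsProbabilityMeasure P] {n : ℕ} (i : Fin (n + 1))
    (f : (Fin (n + 1) → V) → ℝ) {M : ℝ} (hM : ∀ S, |f S| ≤ M) :
    ∫ S, f S ∂(Measure.pi fun _ : Fin (n + 1) => P)
      = ∫ v, ∫ S, f (i.insertNth v S) ∂(Measure.pi fun _ : Fin n => P) ∂P := by
  have h := (measurePreserving_piFinSuccAbove (fun _ : Fin (n + 1) => P) i).symm
  rw [← h.integral_comp', integral_prod]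
  · rfl
  · exact integrable_of_abs_le _ _ fun x => hM _

/-- McDiarmid's bounded difference inequality, in terms of the moment generating function. -/
theorem integral_exp_sub_le_of_bounded_diff (P : Measure V) [IsProbabilityMeasure P] {m : ℕ}
    (f : (Fin m → V) → ℝ) {M c : ℝ} (hM : ∀ S, |f S| ≤ M)
    (hc : ∀ S i v, |f (Function.update S i v) - f S| ≤ c) (l : ℝ) :
    ∫ S, Real.exp (l * (f S - ∫ S', f S' ∂(Measure.pi fun _ : Fin m => P)))
      ∂(Measure.pi fun _ : Fin m => P) ≤ Real.exp (m * (l ^ 2 * c ^ 2 / 2)) := by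
  have hexp : ∀ (M' e x : ℝ), |x| ≤ M' → |e| ≤ M' →
      |Real.exp (l * (x - e))| ≤ Real.exp (|l| * (M' + M')) := by
    intro M' e x hx he
    rw [abs_of_pos (Real.exp_pos _), Real.exp_le_exp]
    calc l * (x - e) ≤ |l * (x - e)| := le_abs_self _
      _ = |l| * |x - e| := abs_mul _ _
      _ ≤ |l| * (M' + M') := by
        gcongr
        exact (abs_sub _ _).trans (add_le_add hx he)
  induction m with
  | zero =>
    have h1 : ∀ S : Fin 0 → V, f S = f default := fun S => congrArg f (Subsingleton.elim _ _)
    simp [h1]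
  | succ m ih =>
    set E := ∫ S', f S' ∂(Measure.pi fun _ : Fin (m + 1) => P) with hE
    have hEM : |E| ≤ M := abs_integral_le _ _ hM
    -- The conditional expectation of `f` given the first point. Induction controls `f - g` for each
    -- fixed first point, and Hoeffding's lemma controls `g - E`.
    set g : V → ℝ := fun v => ∫ S, f ((0 : Fin (m + 1)).insertNth v S)
      ∂(Measure.pi fun _ : Fin m => P) with hg
    have hEg : E = ∫ v, g v ∂P := integral_pi_insertNth P 0 f hM
    have hgM : ∀ v, |g v| ≤ M := fun v => abs_integral_le _ _ fun S => hM _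
    rw [integral_pi_insertNth P 0 _ fun S => hexp M E (f S) (hM S) hEM]
    have hgc : ∀ v w, |g v - g w| ≤ c := by
      intro v w
      rw [hg, ← integral_sub (integrable_of_abs_le _ _ fun S => hM _)
        (integrable_of_abs_le _ _ fun S => hM _)]
      refine abs_integral_le _ _ fun S => ?_
      have := hc ((0 : Fin (m + 1)).insertNth w S) 0 v
      rwa [Fin.update_insertNth] at this
    have hinner : ∀ v, ∫ S, Real.exp (l * (f ((0 : Fin (m + 1)).insertNth v S) - E))
        ∂(Measure.pi fun _ : Fin m => P)
        ≤ Real.exp (m * (l ^ 2 * c ^ 2 / 2)) * Real.exp (l * (g v - ∫ w, g w ∂P)) := by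
      intro v
      have h1 := ih (fun S => f ((0 : Fin (m + 1)).insertNth v S)) (fun S => hM _)
        (fun S i w => by
          have := hc ((0 : Fin (m + 1)).insertNth v S) ((0 : Fin (m + 1)).succAbove i) w
          rwa [← Fin.insertNth_update] at this)
      have h2 : ∀ S : Fin m → V, Real.exp (l * (f ((0 : Fin (m + 1)).insertNth v S) - E))
          = Real.exp (l * (f ((0 : Fin (m + 1)).insertNth v S) - g v))
            * Real.exp (l * (g v - ∫ w, g w ∂P)) := fun S => by
        rw [← Real.exp_add, hEg]; ring_nf
      simp_rw [h2]
      rw [integral_mul_const]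
      exact mul_le_mul_of_nonneg_right h1 (Real.exp_pos _).le
    refine (integral_mono (integrable_of_abs_le _ _ (M := Real.exp (|l| * (M + M))) fun v => ?_)
      ((integrable_of_abs_le _ _ fun v => hexp M _ _ (hgM v) ?_).const_mul _) hinner).trans ?_
    · exact abs_integral_le _ _ fun S => hexp M E _ (hM _) hEM
    · exact abs_integral_le _ _ hgM
    · rw [integral_const_mul]
      have h3 := integral_exp_sub_le_of_abs_sub_le P g hgc l
      refine (mul_le_mul_of_nonneg_left h3 (Real.exp_pos _).le).trans (le_of_eq ?_)
      rw [← Real.exp_add]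
      push_cast
      ring_nf

/-- McDiarmid's bounded difference inequality. -/
theorem measureReal_ge_le_of_bounded_diff (P : Measure V) [IsProbabilityMeasure P] {m : ℕ}
    (hm : 0 < m) (f : (Fin m → V) → ℝ) {M c t : ℝ} (hM : ∀ S, |f S| ≤ M) (hc0 : 0 < c)
    (hc : ∀ S i v, |f (Function.update S i v) - f S| ≤ c) (ht : 0 ≤ t) :
    (Measure.pi fun _ : Fin m => P).real
        {S | (∫ S', f S' ∂(Measure.pi fun _ : Fin m => P)) + t ≤ f S}
      ≤ Real.exp (-(t ^ 2 / (2 * m * c ^ 2))) := by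
  set E := ∫ S', f S' ∂(Measure.pi fun _ : Fin m => P) with hE
  have hm' : (0 : ℝ) < m := by exact_mod_cast hm
  -- The minimizer of `-l * t + m * l ^ 2 * c ^ 2 / 2`.
  set l : ℝ := t / (m * c ^ 2) with hl
  have hl0 : 0 ≤ l := by positivity
  have hEM : |E| ≤ M := abs_integral_le _ _ hM
  have hint : Integrable (fun S => Real.exp (l * (f S - E))) (Measure.pi fun _ : Fin m => P) := by
    refine integrable_of_abs_le _ _ (M := Real.exp (l * (M + M))) fun S => ?_
    rw [abs_of_pos (Real.exp_pos _), Real.exp_le_exp]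
    refine mul_le_mul_of_nonneg_left ?_ hl0
    linarith [(abs_le.1 (hM S)).2, (abs_le.1 hEM).1]
  have h1 := mul_meas_ge_le_integral_of_nonneg
    (Filter.Eventually.of_forall fun S => (Real.exp_pos (l * (f S - E))).le) hint
    (Real.exp (l * t))
  have h2 := integral_exp_sub_le_of_bounded_diff P f hM hc l
  have h3 : {S | E + t ≤ f S} ⊆ {S | Real.exp (l * t) ≤ Real.exp (l * (f S - E))} := by
    intro S hS
    have hS' : E + t ≤ f S := hS
    refine Real.exp_le_exp.2 (mul_le_mul_of_nonneg_left ?_ hl0)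
    linarith
  have h4 := measureReal_mono (μ := Measure.pi fun _ : Fin m => P) h3
  have h5 := mul_le_mul_of_nonneg_left h4 (Real.exp_pos (l * t)).le
  have h6 := h5.trans (h1.trans h2)
  rw [← le_div_iff₀' (Real.exp_pos _), ← Real.exp_sub] at h6
  refine h6.trans (le_of_eq ?_)
  congr 1
  rw [hl]; field_simp; ring

/-! ### Symmetrization and the expected VC deviation -/

theorem abs_ind_le (b : Bool) : |ind b| ≤ 1 := by cases b <;> simp [ind]

theorem abs_ind_sub_le (a b : Bool) : |ind a - ind b| ≤ 1 := by
  cases a <;> cases b <;> simp [ind]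

theorem abs_sgn_mul (b : Bool) (x : ℝ) : |sgn b * x| = |x| := by cases b <;> simp [sgn]

/-- On a countable space it suffices to compare point masses, which are products symmetric in the
two samples. -/
theorem map_swapSamples (P : Measure V) [IsProbabilityMeasure P] {m : ℕ} (σ : Fin m → Bool) :
    Measure.map (swapSamples σ) ((Measure.pi fun _ : Fin m => P).prod
      (Measure.pi fun _ : Fin m => P))
      = (Measure.pi fun _ : Fin m => P).prod (Measure.pi fun _ : Fin m => P) := by
  refine Measure.ext_of_singleton fun x => ?_
  rw [Measure.map_apply Measurable.of_discrete (measurableSet_singleton x)]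
  have h1 : swapSamples σ ⁻¹' {x} = {swapSamples σ x} := by
    ext y
    simp only [Set.mem_preimage, Set.mem_singleton_iff]
    exact (swapSamples_involutive σ).eq_iff
  have h2 : ∀ y : (Fin m → V) × (Fin m → V), ((Measure.pi fun _ : Fin m => P).prod
      (Measure.pi fun _ : Fin m => P)) {y} = ∏ j, (P {y.1 j} * P {y.2 j}) := by
    intro y
    rw [show ({y} : Set ((Fin m → V) × (Fin m → V))) = {y.1} ×ˢ {y.2} by
      rw [Set.singleton_prod_singleton], Measure.prod_prod, Measure.pi_singleton,
      Measure.pi_singleton, Finset.prod_mul_distrib]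
  rw [h1, h2, h2]
  refine Finset.prod_congr rfl fun j _ => ?_
  simp only [swapSamples]
  cases σ j <;> simp [mul_comm]

theorem abs_avg_ind_sub_integral_le {V : Type u} [MeasurableSpace V] {m : ℕ} (P : Measure V)
    [IsProbabilityMeasure P] (a : V → Bool) (S : Fin m → V) :
    |(1 / (m : ℝ)) * ∑ j, ind (a (S j)) - ∫ v, ind (a v) ∂P| ≤ 2 := by
  have h3 : |(1 / (m : ℝ)) * ∑ j, ind (a (S j))| ≤ 1 := by
    rw [abs_mul, abs_of_nonneg (show (0 : ℝ) ≤ 1 / m by positivity), one_div]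
    refine inv_mul_le_one_of_le₀ ?_ (by positivity)
    exact (Finset.abs_sum_le_sum_abs _ _).trans
      ((Finset.sum_le_sum fun j _ => abs_ind_le _).trans (by simp))
  have h4 : |∫ v, ind (a v) ∂P| ≤ 1 := abs_integral_le _ _ fun v => abs_ind_le _
  exact (abs_sub _ _).trans (by linarith)

/-- Symmetrization. -/
theorem integral_ciSup_deviation_le_rademacher {m : ℕ} {ι : Type*} (a : ι → V → Bool)
    (P : Measure V) [IsProbabilityMeasure P] (σ : Fin m → Bool) :
    ∫ x : (Fin m → V) × (Fin m → V), ⨆ i, |∑ j, (ind (a i (x.1 j)) - ind (a i (x.2 j)))|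
        ∂((Measure.pi fun _ : Fin m => P).prod (Measure.pi fun _ : Fin m => P))
      ≤ 2 * ∫ S, ⨆ i, |∑ j, sgn (σ j) * ind (a i (S j))| ∂(Measure.pi fun _ : Fin m => P) := by
  set μ := Measure.pi fun _ : Fin m => P with hμ
  have hR : ∀ (S : Fin m → V) i, |∑ j, sgn (σ j) * ind (a i (S j))| ≤ m := fun S i =>
    (Finset.abs_sum_le_sum_abs _ _).trans ((Finset.sum_le_sum fun j _ =>
      (abs_sgn_mul _ _).trans_le (abs_ind_le _)).trans (by simp))
  have hΦ : ∀ (x : (Fin m → V) × (Fin m → V)) i,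
      |∑ j, (ind (a i (x.1 j)) - ind (a i (x.2 j)))| ≤ m := fun x i =>
    (Finset.abs_sum_le_sum_abs _ _).trans
      ((Finset.sum_le_sum fun j _ => abs_ind_sub_le _ _).trans (by simp))
  have hRint : Integrable (fun S : Fin m → V => ⨆ i, |∑ j, sgn (σ j) * ind (a i (S j))|) μ :=
    integrable_of_abs_le _ _ fun S => abs_ciSup_abs_le _ (Nat.cast_nonneg m) (hR S)
  have h1 : ∀ x : (Fin m → V) × (Fin m → V), (⨆ i, |∑ j, (ind (a i ((swapSamples σ x).1 j))
      - ind (a i ((swapSamples σ x).2 j)))|) ≤ (⨆ i, |∑ j, sgn (σ j) * ind (a i (x.1 j))|)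
        + ⨆ i, |∑ j, sgn (σ j) * ind (a i (x.2 j))| := by
    intro x
    refine Real.iSup_le (fun i => ?_) (add_nonneg (ciSup_abs_nonneg _) (ciSup_abs_nonneg _))
    have h2 : ∑ j, (ind (a i ((swapSamples σ x).1 j)) - ind (a i ((swapSamples σ x).2 j)))
        = ∑ j, sgn (σ j) * ind (a i (x.1 j)) - ∑ j, sgn (σ j) * ind (a i (x.2 j)) := by
      rw [← Finset.sum_sub_distrib]
      refine Finset.sum_congr rfl fun j _ => ?_
      simp only [swapSamples, sgn]
      cases σ j <;> simp [neg_add_eq_sub]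
    rw [h2]
    exact (abs_sub _ _).trans (add_le_add (le_ciSup_abs _ (hR x.1) i) (le_ciSup_abs _ (hR x.2) i))
  -- Swapping leaves the law unchanged but introduces the signs `σ`; the bound holds for each fixed
  -- `σ`, and averaging over `σ` comes later.
  rw [← map_swapSamples P σ, integral_map Measurable.of_discrete.aemeasurable
    Measurable.of_discrete.aestronglyMeasurable]
  refine (integral_mono (integrable_of_abs_le _ _ fun x =>
    abs_ciSup_abs_le _ (Nat.cast_nonneg m) (hΦ _))
    ((hRint.comp_fst μ).add (hRint.comp_snd μ)) h1).trans (le_of_eq ?_)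
  rw [integral_add' (hRint.comp_fst μ) (hRint.comp_snd μ),
    integral_fun_fst (fun S : Fin m → V => ⨆ i, |∑ j, sgn (σ j) * ind (a i (S j))|),
    integral_fun_snd (fun S : Fin m → V => ⨆ i, |∑ j, sgn (σ j) * ind (a i (S j))|)]
  simp [two_mul]

/-- The expected uniform deviation of a class of VC dimension at most `d`. -/
theorem integral_ciSup_deviation_le {m d : ℕ} (hm : 0 < m) {ι : Type*} [Nonempty ι]
    (a : ι → V → Bool) (ha : VCDimLE (Set.range a) d) (P : Measure V) [IsProbabilityMeasure P] :
    ∫ S, ⨆ i, |(1 / (m : ℝ)) * ∑ j, ind (a i (S j)) - ∫ v, ind (a i v) ∂P|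
        ∂(Measure.pi fun _ : Fin m => P)
      ≤ 66 * √((max d 1 : ℕ) / m) := by
  have hm' : (0 : ℝ) < m := by exact_mod_cast hm
  set μ := Measure.pi fun _ : Fin m => P with hμ
  set Φ : (Fin m → V) × (Fin m → V) → ℝ :=
    fun x => ⨆ i, |∑ j, (ind (a i (x.1 j)) - ind (a i (x.2 j)))| with hΦdef
  have hΦ : ∀ (x : (Fin m → V) × (Fin m → V)) i,
      |∑ j, (ind (a i (x.1 j)) - ind (a i (x.2 j)))| ≤ m := fun x i =>
    (Finset.abs_sum_le_sum_abs _ _).trans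
      ((Finset.sum_le_sum fun j _ => abs_ind_sub_le _ _).trans (by simp))
  have hΦM : ∀ x, |Φ x| ≤ m := fun x => abs_ciSup_abs_le _ hm'.le (hΦ x)
  have hΦint : Integrable Φ (μ.prod μ) := integrable_of_abs_le _ _ hΦM
  have hR : ∀ σ : Fin m → Bool, Integrable (fun S : Fin m → V => ⨆ i, |∑ j, sgn (σ j) * ind (a i (S j))|) μ :=
    fun σ => integrable_of_abs_le _ _ (M := m) fun S => abs_ciSup_abs_le _ hm'.le fun i =>
      (Finset.abs_sum_le_sum_abs _ _).trans ((Finset.sum_le_sum fun j _ =>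
      (abs_sgn_mul _ _).trans_le (abs_ind_le _)).trans (by simp))
  have h1 : ∀ S, (⨆ i, |(1 / (m : ℝ)) * ∑ j, ind (a i (S j)) - ∫ v, ind (a i v) ∂P|)
      ≤ (1 / m) * ∫ S', Φ (S, S') ∂μ := by
    intro S
    refine ciSup_le fun i => ?_
    -- Ghost sample: the true mean is the expected empirical mean of an independent copy `S'`.
    have h2 : (1 / (m : ℝ)) * ∑ j, ind (a i (S j)) - ∫ v, ind (a i v) ∂P
        = (1 / m) * ∫ S', ∑ j, (ind (a i (S j)) - ind (a i (S' j))) ∂μ := by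
      rw [integral_finsetSum _ fun j _ =>
        integrable_of_abs_le _ _ fun S' => abs_ind_sub_le _ _]
      have h3 : ∀ j : Fin m, ∫ S' : Fin m → V, (ind (a i (S j)) - ind (a i (S' j))) ∂μ
          = ind (a i (S j)) - ∫ v, ind (a i v) ∂P := by
        intro j
        rw [integral_sub (integrable_const _) (integrable_of_abs_le _ _ fun S' => abs_ind_le _),
          integral_pi_eval P j fun v => ind (a i v)]
        simp
      simp_rw [h3]
      rw [Finset.sum_sub_distrib]
      simp
      field_simp
    rw [h2, abs_mul, abs_of_pos (show (0 : ℝ) < 1 / m by positivity)]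
    refine mul_le_mul_of_nonneg_left ?_ (by positivity)
    refine abs_integral_le_integral_abs.trans (integral_mono ?_ ?_ fun S' => ?_)
    · exact (integrable_of_abs_le _ _ fun S' => hΦ (S, S') i).abs
    · exact integrable_of_abs_le _ _ fun S' => hΦM (S, S')
    · exact le_ciSup_abs _ (hΦ (S, S')) i
  have h2 : ∫ S, ⨆ i, |(1 / (m : ℝ)) * ∑ j, ind (a i (S j)) - ∫ v, ind (a i v) ∂P| ∂μ
      ≤ (1 / m) * ∫ x, Φ x ∂(μ.prod μ) := by
    rw [integral_prod _ hΦint, ← integral_const_mul]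
    refine integral_mono (integrable_of_abs_le _ _ (M := 2) fun S =>
      abs_ciSup_abs_le _ (by norm_num) fun i => abs_avg_ind_sub_integral_le P (a i) S)
      (hΦint.integral_prod_left.const_mul _) h1
  have h3 : (2 : ℝ) ^ m * ∫ x, Φ x ∂(μ.prod μ) ≤ 2 * (2 ^ m * (33 * (√((max d 1 : ℕ) / m) * m))) := by
    calc (2 : ℝ) ^ m * ∫ x, Φ x ∂(μ.prod μ) = ∑ _σ : Fin m → Bool, ∫ x, Φ x ∂(μ.prod μ) := by simp
      _ ≤ ∑ σ : Fin m → Bool, 2 * ∫ S, ⨆ i, |∑ j, sgn (σ j) * ind (a i (S j))| ∂μ :=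
          Finset.sum_le_sum fun σ _ => integral_ciSup_deviation_le_rademacher a P σ
      _ = 2 * ∫ S, ∑ σ : Fin m → Bool, ⨆ i, |∑ j, sgn (σ j) * ind (a i (S j))| ∂μ := by
          rw [← Finset.mul_sum, integral_finsetSum _ fun σ _ => hR σ]
      _ ≤ 2 * (2 ^ m * (33 * (√((max d 1 : ℕ) / m) * m))) := by
          refine mul_le_mul_of_nonneg_left ?_ (by norm_num)
          refine (integral_mono (integrable_finsetSum _ fun σ _ => hR σ) (integrable_const _)
            fun S => sum_ciSup_rademacher_le hm a ha S).trans (by simp)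
  have h4 : ∫ x, Φ x ∂(μ.prod μ) ≤ 66 * √((max d 1 : ℕ) / m) * m := by
    have : (0 : ℝ) < 2 ^ m := by positivity
    rw [← mul_le_mul_iff_right₀ this]
    linarith
  refine h2.trans ?_
  rw [one_div, inv_mul_le_iff₀ hm']
  linarith

end

/-! ### Empirical frequencies, projections and slices of hypergraphs -/

theorem empFreq_eq {V : Type u} {k m : ℕ} (S : Fin m → V) (g : Hypergraph V k) :
    empFreq S g = (1 / (m : ℝ) ^ k) * ∑ i : Fin k → Fin m, ind (g fun j => S (i j)) := rfl

theorem empFreq_succ {V : Type u} {k m : ℕ} (S : Fin m → V) (g : Hypergraph V (k + 1)) :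
    empFreq S g = (1 / (m : ℝ)) * ∑ i, empFreq S (Hypergraph.proj (S i) g) := by
  simp_rw [empFreq_eq]
  rw [← (Fin.consEquiv fun _ : Fin (k + 1) => Fin m).sum_comp, Fintype.sum_prod_type,
    ← Finset.mul_sum, ← mul_assoc]
  congr 1
  · rw [pow_succ, one_div_mul_one_div, mul_comm]
  · refine Finset.sum_congr rfl fun i _ => Finset.sum_congr rfl fun f _ => ?_
    congr 1
    simp only [Hypergraph.proj]
    congr 1
    exact Fin.comp_cons S i f

theorem abs_empFreq_le {V : Type u} {k m : ℕ} (S : Fin m → V) (g : Hypergraph V k) :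
    |empFreq S g| ≤ 1 := by
  rw [empFreq_eq, abs_mul, abs_of_nonneg (show (0 : ℝ) ≤ 1 / (m : ℝ) ^ k by positivity), one_div]
  refine inv_mul_le_one_of_le₀ ?_ (by positivity)
  exact (Finset.abs_sum_le_sum_abs _ _).trans
    ((Finset.sum_le_sum fun i _ => abs_ind_le _).trans (by simp))

/-- Changing one sample point changes the empirical frequency by at most `k / m`. -/
theorem abs_empFreq_update_sub_le {V : Type u} {k m : ℕ} (g : Hypergraph V k) (S : Fin m → V)
    (i : Fin m) (v : V) : |empFreq (Function.update S i v) g - empFreq S g| ≤ k / m := by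
  have hm : (0 : ℝ) < m := by exact_mod_cast i.pos
  induction k with
  | zero =>
    have h1 : ∀ S : Fin m → V, ∀ j : Fin 0 → Fin m, (fun l => S (j l)) = Fin.elim0 :=
      fun S j => Subsingleton.elim _ _
    simp [empFreq_eq, h1]
  | succ k ih =>
    set S' := Function.update S i v with hS'
    rw [empFreq_succ, empFreq_succ, ← mul_sub, ← Finset.sum_sub_distrib, abs_mul,
      abs_of_pos (show (0 : ℝ) < 1 / m by positivity), one_div, inv_mul_le_iff₀ hm]
    have h1 : ∀ j, |empFreq S' (Hypergraph.proj (S' j) g) - empFreq S (Hypergraph.proj (S j) g)|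
        ≤ k / m + if j = i then 1 else 0 := by
      intro j
      -- At `j = i` the projected hypergraph itself changes, but both frequencies lie in `[0, 1]`;
      -- elsewhere the hypergraph is fixed and induction applies.
      by_cases hj : j = i
      · rw [if_pos hj, hj]
        have h0 : ∀ (T : Fin m → V) (h : Hypergraph V k), 0 ≤ empFreq T h := fun T h => by
          rw [empFreq_eq]
          refine mul_nonneg (by positivity) (Finset.sum_nonneg fun _ _ => ?_)
          unfold ind; split_ifs <;> norm_num
        have h2 := (abs_le.1 (abs_empFreq_le S' (Hypergraph.proj (S' i) g))).2
        have h3 := (abs_le.1 (abs_empFreq_le S (Hypergraph.proj (S i) g))).2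
        have h4 := h0 S' (Hypergraph.proj (S' i) g)
        have h5 := h0 S (Hypergraph.proj (S i) g)
        have h6 : (0 : ℝ) ≤ k / m := by positivity
        exact abs_le.2 ⟨by linarith, by linarith⟩
      · rw [if_neg hj, add_zero, hS', Function.update_of_ne hj]
        exact ih _
    refine (Finset.abs_sum_le_sum_abs _ _).trans ((Finset.sum_le_sum fun j _ => h1 j).trans ?_)
    rw [Finset.sum_add_distrib]
    simp
    field_simp
    simp

theorem IsUndirected.proj {V : Type u} {k : ℕ} {g : Hypergraph V (k + 1)} (hg : IsUndirected g)
    (v : V) : IsUndirected (Hypergraph.proj v g) := by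
  intro π w
  -- This permutation fixes `0` and acts as `π` on the other coordinates.
  have h := hg (Equiv.Perm.decomposeFin.symm (0, π)) (Fin.cons v w)
  simp only [Hypergraph.proj]
  rw [← h]
  congr 1
  funext i
  refine Fin.cases ?_ (fun j => ?_) i <;> simp

theorem IsDistinguishingClass.proj {V : Type u} {k : ℕ} {G : Set (Hypergraph V (k + 1))}
    (hG : IsDistinguishingClass G) (v : V) :
    IsDistinguishingClass (Hypergraph.proj v '' G) := by
  rintro _ ⟨g, hg, rfl⟩
  exact (hG g hg).proj v

theorem gVC_proj_le {V : Type u} {k : ℕ} {G : Set (Hypergraph V (k + 1))} {d : ℕ}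
    (h : gVC (k + 1) G ≤ (d : ℕ∞)) (v : V) : gVC k (Hypergraph.proj v '' G) ≤ (d : ℕ∞) := by
  cases k with
  -- The default value `gVC 0 = 0` makes the bound hold at the bottom level.
  | zero => exact zero_le
  | succ k => exact (le_iSup (fun v => gVC (k + 1) (Hypergraph.proj v '' G)) v).trans h

/-- Fixing all vertices but the first gives a class of VC dimension at most the graph VC
dimension. -/
theorem vcDimLE_slice {V : Type u} {k : ℕ} {G : Set (Hypergraph V (k + 1))} {d : ℕ}
    (hG : IsDistinguishingClass G) (h : gVC (k + 1) G ≤ (d : ℕ∞)) (u : Fin k → V) :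
    VCDimLE (Set.range fun (g : G) (v : V) => (g : Hypergraph V (k + 1)) (Fin.cons v u)) d := by
  induction k with
  | zero =>
    refine (vcDim_le_iff.1 h).mono ?_
    rintro _ ⟨g, rfl⟩
    refine ⟨g, g.2, funext fun v => ?_⟩
    simp only [Hypergraph.toBoolFun]
    refine congrArg (g : Hypergraph V 1) (funext fun i => ?_)
    rw [Subsingleton.elim i 0]; rfl
  | succ k ih =>
    refine (ih (hG.proj (u 0)) (gVC_proj_le h (u 0)) (Fin.tail u)).mono ?_
    rintro _ ⟨g, rfl⟩
    refine ⟨⟨_, g, g.2, rfl⟩, funext fun v => ?_⟩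
    simp only [Hypergraph.proj]
    -- Symmetry moves `u 0` to the front, so the slice of `g` becomes a slice of the projection at
    -- `u 0`, with `v` still free.
    rw [← hG g g.2 (Equiv.swap 0 1)]
    refine congrArg (g : Hypergraph V (k + 2)) (funext fun i => ?_)
    refine Fin.cases ?_ (fun j => Fin.cases ?_ (fun l => ?_) j) i
    · simp
    · simp
    · rw [Equiv.swap_apply_of_ne_of_ne (Fin.succ_ne_zero _)
        (by rw [← Fin.succ_zero_eq_one]; exact (Fin.succ_injective _).ne (Fin.succ_ne_zero _))]
      simp [Fin.tail]

/-! ### The deviation and the induction on the arity -/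

theorem deviation_nonneg {V : Type u} [MeasurableSpace V] {k m : ℕ} (G : Set (Hypergraph V k))
    (P : Measure V) (S : Fin m → V) : 0 ≤ deviation G P S := by
  unfold deviation
  exact ciSup_abs_nonneg _

theorem deviation_le {V : Type u} [MeasurableSpace V] {k m : ℕ} {G : Set (Hypergraph V k)}
    (P : Measure V) (S : Fin m → V) {a : ℝ} (ha : 0 ≤ a)
    (h : ∀ g ∈ G, |empFreq S g - freq P g| ≤ a) : deviation G P S ≤ a := by
  unfold deviation
  exact Real.iSup_le (fun g => h g.1 g.2) ha

theorem abs_le_deviation {V : Type u} [MeasurableSpace V] {k m : ℕ} {G : Set (Hypergraph V k)}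
    (P : Measure V) [IsProbabilityMeasure P] (S : Fin m → V) {g : Hypergraph V k} (hg : g ∈ G) :
    |empFreq S g - freq P g| ≤ deviation G P S := by
  unfold deviation
  exact le_ciSup (bddAbove_deviation G P S) (⟨g, hg⟩ : G)

theorem deviation_update_le {V : Type u} [MeasurableSpace V] {k m : ℕ} (G : Set (Hypergraph V k))
    (P : Measure V) [IsProbabilityMeasure P] (S T : Fin m → V)
    (h : ∀ g : Hypergraph V k, |empFreq T g - empFreq S g| ≤ k / m) :
    deviation G P T ≤ deviation G P S + k / m := by
  have h0 : (0 : ℝ) ≤ k / m := by positivity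
  refine deviation_le P T (add_nonneg (deviation_nonneg G P S) h0) fun g hg => ?_
  have h1 := abs_le_deviation P S hg
  have h2 := h g
  have h3 := abs_sub_le (empFreq T g) (empFreq S g) (freq P g)
  linarith

theorem abs_deviation_update_sub_le {V : Type u} [MeasurableSpace V] {k m : ℕ} (G : Set (Hypergraph V k))
    (P : Measure V) [IsProbabilityMeasure P] (S : Fin m → V) (i : Fin m) (v : V) :
    |deviation G P (Function.update S i v) - deviation G P S| ≤ k / m := by
  have h1 := deviation_update_le G P S (Function.update S i v) fun g =>
    abs_empFreq_update_sub_le g S i v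
  have h2 := deviation_update_le G P (Function.update S i v) S fun g => by
    rw [abs_sub_comm]; exact abs_empFreq_update_sub_le g S i v
  exact abs_le.2 ⟨by linarith, by linarith⟩

section

variable {V : Type u} [Countable V] [MeasurableSpace V] [DiscreteMeasurableSpace V]

theorem freq_eq_integral {k : ℕ} (P : Measure V) (g : Hypergraph V k) :
    freq P g = ∫ w, ind (g w) ∂(Measure.pi fun _ : Fin k => P) := by
  rw [freq, ← integral_indicator_one (MeasurableSet.of_discrete)]
  refine integral_congr_ae (Filter.Eventually.of_forall fun w => ?_)
  simp [Set.indicator, ind]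

theorem abs_freq_le {k : ℕ} (P : Measure V) [IsProbabilityMeasure P] (g : Hypergraph V k) :
    |freq P g| ≤ 1 := by
  rw [freq_eq_integral]
  exact abs_integral_le _ _ fun w => abs_ind_le _

theorem freq_succ {k : ℕ} (P : Measure V) [IsProbabilityMeasure P] (g : Hypergraph V (k + 1)) :
    freq P g = ∫ w, ∫ v, ind (g (Fin.cons v w)) ∂P ∂(Measure.pi fun _ : Fin k => P) := by
  rw [freq_eq_integral, integral_pi_insertNth P 0 _ fun w => abs_ind_le (g w)]
  simp only [Fin.insertNth_zero']
  exact integral_integral_swap (integrable_of_abs_le _ _ fun x => abs_ind_le _)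

theorem abs_empFreq_sub_freq_le {k m : ℕ} (P : Measure V) [IsProbabilityMeasure P]
    (S : Fin m → V) (g : Hypergraph V k) : |empFreq S g - freq P g| ≤ 2 :=
  (abs_sub _ _).trans (by linarith [abs_empFreq_le S g, abs_freq_le P g])

theorem abs_deviation_le {k m : ℕ} (G : Set (Hypergraph V k)) (P : Measure V)
    [IsProbabilityMeasure P] (S : Fin m → V) : |deviation G P S| ≤ 2 := by
  rw [abs_of_nonneg (deviation_nonneg G P S)]
  exact deviation_le P S (by norm_num) fun g _ => abs_empFreq_sub_freq_le P S g

/-- Decoupling a parameter taken from the sample, for functions of bounded differences. -/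
theorem integral_diag_le (P : Measure V) [IsProbabilityMeasure P] {m : ℕ} (i : Fin m)
    (F : V → (Fin m → V) → ℝ) {M c : ℝ} (hM : ∀ v S, |F v S| ≤ M)
    (hc : ∀ v S w, |F v (Function.update S i w) - F v S| ≤ c) :
    ∫ S, F (S i) S ∂(Measure.pi fun _ : Fin m => P)
      ≤ (∫ v, ∫ S, F v S ∂(Measure.pi fun _ : Fin m => P) ∂P) + c := by
  obtain ⟨n, rfl⟩ : ∃ n, m = n + 1 := ⟨m - 1, by have := i.pos; omega⟩
  have hint : ∀ v w, Integrable (fun S => F v (i.insertNth w S))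
      (Measure.pi fun _ : Fin n => P) := fun v w => integrable_of_abs_le _ _ fun S => hM _ _
  have hbd : ∀ v w, |∫ S, F v (i.insertNth w S) ∂(Measure.pi fun _ : Fin n => P)| ≤ M :=
    fun v w => abs_integral_le _ _ fun S => hM _ _
  have hS : ∀ v, ∫ S, F v S ∂(Measure.pi fun _ : Fin (n + 1) => P)
      = ∫ w, ∫ S, F v (i.insertNth w S) ∂(Measure.pi fun _ : Fin n => P) ∂P :=
    fun v => integral_pi_insertNth P i _ (hM v)
  rw [integral_pi_insertNth P i (fun S => F (S i) S) fun S => hM _ _]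
  simp only [Fin.insertNth_apply_same, hS]
  -- Replacing the `i`-th point `v` by an independent `w` costs at most `c`, while the parameter
  -- stays `v`.
  have h1 : ∀ v w, ∫ S, F v (i.insertNth v S) ∂(Measure.pi fun _ : Fin n => P)
      ≤ (∫ S, F v (i.insertNth w S) ∂(Measure.pi fun _ : Fin n => P)) + c := by
    intro v w
    rw [← sub_le_iff_le_add', ← integral_sub (hint v v) (hint v w)]
    refine (le_abs_self _).trans (abs_integral_le _ _ fun S => ?_)
    have := hc v (i.insertNth w S) v
    rwa [Fin.update_insertNth] at this
  have h2 : ∀ v, ∫ S, F v (i.insertNth v S) ∂(Measure.pi fun _ : Fin n => P)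
      ≤ (∫ w, ∫ S, F v (i.insertNth w S) ∂(Measure.pi fun _ : Fin n => P) ∂P) + c := by
    intro v
    have := integral_mono (μ := P) (integrable_const _)
      ((integrable_of_abs_le P _ fun w => hbd v w).add (integrable_const c)) (h1 v)
    rw [integral_add' (integrable_of_abs_le P _ fun w => hbd v w) (integrable_const c)] at this
    simpa using this
  have hint2 : Integrable (fun v => ∫ w, ∫ S, F v (i.insertNth w S)
      ∂(Measure.pi fun _ : Fin n => P) ∂P) P :=
    integrable_of_abs_le P _ fun v => abs_integral_le _ _ (hbd v)
  have := integral_mono (integrable_of_abs_le P _ fun v => hbd v v)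
    (hint2.add (integrable_const c)) h2
  rw [integral_add' hint2 (integrable_const c)] at this
  simpa using this

/-- The part of the deviation of a `(k + 1)`-hypergraph that is due to the first vertex. -/
theorem abs_avg_freq_proj_sub_freq_le {k m : ℕ} (hm : 0 < m) {G : Set (Hypergraph V (k + 1))}
    (P : Measure V) [IsProbabilityMeasure P] (S : Fin m → V) {g : Hypergraph V (k + 1)}
    (hg : g ∈ G) :
    |(1 / (m : ℝ)) * ∑ i, freq P (Hypergraph.proj (S i) g) - freq P g|
      ≤ ∫ u, ⨆ h : G, |(1 / (m : ℝ)) * ∑ i, ind ((h : Hypergraph V (k + 1)) (Fin.cons (S i) u))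
          - ∫ v, ind ((h : Hypergraph V (k + 1)) (Fin.cons v u)) ∂P|
          ∂(Measure.pi fun _ : Fin k => P) := by
  have hm' : (0 : ℝ) < m := by exact_mod_cast hm
  have hbd : ∀ (h : Hypergraph V (k + 1)) (u : Fin k → V),
      |(1 / (m : ℝ)) * ∑ i, ind (h (Fin.cons (S i) u)) - ∫ v, ind (h (Fin.cons v u)) ∂P| ≤ 2 := by
    intro h u
    exact abs_avg_ind_sub_integral_le P (fun v => h (Fin.cons v u)) S
  -- By Fubini this is an average over `u` of one-variable deviations of `v ↦ g(v, u)`, so the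
  -- supremum can be taken inside for each `u`.
  have h1 : (1 / (m : ℝ)) * ∑ i, freq P (Hypergraph.proj (S i) g) - freq P g
      = ∫ u, ((1 / (m : ℝ)) * ∑ i, ind (g (Fin.cons (S i) u)) - ∫ v, ind (g (Fin.cons v u)) ∂P)
        ∂(Measure.pi fun _ : Fin k => P) := by
    have hi : ∀ i ∈ Finset.univ, Integrable (fun u : Fin k → V => ind (g (Fin.cons (S i) u)))
        (Measure.pi fun _ : Fin k => P) := fun i _ => integrable_of_abs_le _ _ fun _ => abs_ind_le _
    rw [integral_sub ((integrable_finsetSum _ hi).const_mul _)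
      (integrable_of_abs_le _ _ (M := 1) fun u => abs_integral_le _ _ fun v => abs_ind_le _),
      integral_const_mul, integral_finsetSum _ hi, ← freq_succ]
    simp_rw [freq_eq_integral]
    rfl
  rw [h1]
  refine abs_integral_le_integral_abs.trans (integral_mono
    (integrable_of_abs_le _ _ (hbd g)).abs (integrable_of_abs_le _ _ (M := 2) fun u =>
      abs_ciSup_abs_le _ (by norm_num) fun h => hbd h u) fun u => ?_)
  exact le_ciSup_abs (fun h : G => (1 / (m : ℝ)) * ∑ i,
    ind ((h : Hypergraph V (k + 1)) (Fin.cons (S i) u))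
      - ∫ v, ind ((h : Hypergraph V (k + 1)) (Fin.cons v u)) ∂P) (fun h => hbd h u) ⟨g, hg⟩

/-- Triangle inequality through the sample average of the true frequencies of `g_{S i}`; this is the
recursion behind the bound on the mean. -/
theorem deviation_succ_le {k m : ℕ} (hm : 0 < m) (G : Set (Hypergraph V (k + 1)))
    (P : Measure V) [IsProbabilityMeasure P] (S : Fin m → V) :
    deviation G P S ≤ (1 / (m : ℝ)) * (∑ i, deviation (Hypergraph.proj (S i) '' G) P S)
      + ∫ u, ⨆ h : G, |(1 / (m : ℝ)) * ∑ i, ind ((h : Hypergraph V (k + 1)) (Fin.cons (S i) u))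
          - ∫ v, ind ((h : Hypergraph V (k + 1)) (Fin.cons v u)) ∂P|
          ∂(Measure.pi fun _ : Fin k => P) := by
  have hm' : (0 : ℝ) < 1 / m := by positivity
  refine deviation_le P S (add_nonneg (mul_nonneg hm'.le
    (Finset.sum_nonneg fun i _ => deviation_nonneg _ P S))
    (integral_nonneg fun u => ciSup_abs_nonneg _)) fun g hg => ?_
  refine (abs_sub_le _ ((1 / (m : ℝ)) * ∑ i, freq P (Hypergraph.proj (S i) g)) _).trans
    (add_le_add ?_ (abs_avg_freq_proj_sub_freq_le hm P S hg))
  rw [empFreq_succ, ← mul_sub, ← Finset.sum_sub_distrib, abs_mul, abs_of_pos hm']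
  refine mul_le_mul_of_nonneg_left ?_ hm'.le
  exact (Finset.abs_sum_le_sum_abs _ _).trans (Finset.sum_le_sum fun i _ =>
    abs_le_deviation P S ⟨g, hg, rfl⟩)

/-- The expected uniform deviation of a class of graph VC dimension at most `d`. -/
theorem integral_deviation_le {k m d : ℕ} (hm : 0 < m) (G : Set (Hypergraph V k))
    (hGne : G.Nonempty) (hG : IsDistinguishingClass G) (h : gVC k G ≤ (d : ℕ∞)) (P : Measure V)
    [IsProbabilityMeasure P] :
    ∫ S, deviation G P S ∂(Measure.pi fun _ : Fin m => P)
      ≤ k * (66 * √((max d 1 : ℕ) / m)) + (k : ℝ) ^ 2 / m := by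
  have hm' : (0 : ℝ) < m := by exact_mod_cast hm
  induction k with
  | zero =>
    have h0 : ∀ S : Fin m → V, deviation G P S = 0 := by
      intro S
      refine le_antisymm (deviation_le P S le_rfl fun g _ => ?_) (deviation_nonneg G P S)
      have h1 : ∀ w : Fin 0 → V, g w = g Fin.elim0 :=
        fun w => congrArg _ (Subsingleton.elim _ _)
      rw [freq_eq_integral, empFreq_eq]
      simp [h1]
    simp [h0]
  | succ k ih =>
    have := hGne.to_subtype
    set B := 66 * √((max d 1 : ℕ) / m) with hB
    set W : (Fin k → V) → (Fin m → V) → ℝ := fun u S =>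
      ⨆ h : G, |(1 / (m : ℝ)) * ∑ i, ind ((h : Hypergraph V (k + 1)) (Fin.cons (S i) u))
          - ∫ v, ind ((h : Hypergraph V (k + 1)) (Fin.cons v u)) ∂P| with hW
    have hWM : ∀ u S, |W u S| ≤ 2 := by
      intro u S
      exact abs_ciSup_abs_le _ (by norm_num) fun h =>
        abs_avg_ind_sub_integral_le P (fun v => (h : Hypergraph V (k + 1)) (Fin.cons v u)) S
    have h1 : ∀ i : Fin m, ∫ S, deviation (Hypergraph.proj (S i) '' G) P S
        ∂(Measure.pi fun _ : Fin m => P) ≤ k * B + (k : ℝ) ^ 2 / m + k / m := by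
      intro i
      refine (integral_diag_le P i (fun v S => deviation (Hypergraph.proj v '' G) P S)
        (fun v S => abs_deviation_le _ P S)
        (fun v S w => abs_deviation_update_sub_le _ P S i w)).trans ?_
      refine add_le_add ?_ le_rfl
      refine (integral_mono (integrable_of_abs_le P _ fun v => abs_integral_le _ _ fun S =>
        abs_deviation_le _ P S) (integrable_const _) fun v =>
        ih (Hypergraph.proj v '' G) (hGne.image _) (hG.proj v) (gVC_proj_le h v)).trans ?_
      simp
    have h2 : ∫ S, ∫ u, W u S ∂(Measure.pi fun _ : Fin k => P) ∂(Measure.pi fun _ : Fin m => P)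
        ≤ B := by
      -- Here `u` is independent of the sample, so it can be fixed first and the VC bound applied to
      -- its slice class.
      rw [integral_integral_swap (integrable_of_abs_le _ _ fun x => hWM _ _)]
      refine (integral_mono (integrable_of_abs_le _ _ fun u => abs_integral_le _ _ (hWM u))
        (integrable_const B) fun u => integral_ciSup_deviation_le hm _
          (vcDimLE_slice hG h u) P).trans ?_
      simp
    have hint1 : ∀ i ∈ Finset.univ, Integrable
        (fun S : Fin m → V => deviation (Hypergraph.proj (S i) '' G) P S)
        (Measure.pi fun _ : Fin m => P) := fun i _ =>
      integrable_of_abs_le _ _ fun S => abs_deviation_le _ P S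
    have hint2 : Integrable (fun S : Fin m → V => ∫ u, W u S ∂(Measure.pi fun _ : Fin k => P))
        (Measure.pi fun _ : Fin m => P) :=
      integrable_of_abs_le _ _ fun S => abs_integral_le _ _ fun u => hWM u S
    have hint3 := (integrable_finsetSum _ hint1).const_mul (1 / (m : ℝ))
    refine (integral_mono (integrable_of_abs_le _ _ fun S => abs_deviation_le G P S)
      (hint3.add hint2) fun S => deviation_succ_le hm G P S).trans ?_
    rw [integral_add' hint3 hint2, integral_const_mul, integral_finsetSum _ hint1]
    have h3 : (1 / (m : ℝ)) * ∑ i, ∫ S, deviation (Hypergraph.proj (S i) '' G) P S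
        ∂(Measure.pi fun _ : Fin m => P) ≤ k * B + (k : ℝ) ^ 2 / m + k / m := by
      rw [one_div, inv_mul_le_iff₀ hm']
      exact (Finset.sum_le_sum fun i _ => h1 i).trans
        (by rw [Finset.sum_const, Finset.card_univ, Fintype.card_fin, nsmul_eq_mul])
    have h4 : ((k + 1 : ℕ) : ℝ) * B + ((k + 1 : ℕ) : ℝ) ^ 2 / m
        = k * B + (k : ℝ) ^ 2 / m + k / m + B + (k + 1) / m := by push_cast; ring
    have h5 : (0 : ℝ) ≤ (k + 1) / m := by positivity
    linarith

end

end GraphDiscrimination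

/-! ### Concentration around the mean: the theorem -/

theorem mainTheorem1 :
    ∃ C : ℝ, 0 < C ∧
      ∀ (V : Type u) [Countable V] [MeasurableSpace V] [DiscreteMeasurableSpace V]
        (k : ℕ) (_ : 1 ≤ k)
        (G : Set (GraphDiscrimination.Hypergraph V k))
        (_ : GraphDiscrimination.IsDistinguishingClass G)
        (ρ : ℕ) (_ : GraphDiscrimination.gVC k G = (ρ : ℕ∞))
        (P : Measure V) [IsProbabilityMeasure P]
        (ε δ : ℝ) (_ : 0 < ε) (_ : 0 < δ) (_ : δ < 1)
        (m : ℕ) (_ : C * (((max ρ 1 : ℕ) : ℝ) * (k : ℝ) ^ 2 / ε ^ 2 * Real.log (2 / δ)) ≤ (m : ℝ)),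
        1 - δ ≤ (Measure.pi fun _ : Fin m => P).real
          {S : Fin m → V | GraphDiscrimination.deviation G P S ≤ ε} := by
  -- The main demand is `66 * k * √(D / m) ≤ ε / 4`, that is `m ≥ 264 ^ 2 * D * k ^ 2 / ε ^ 2`; as
  -- only `L ≥ 1 / 2` is known, any constant from `2 * 264 ^ 2 = 139392` on meets it.
  refine ⟨200000, by norm_num, ?_⟩
  intro V _ _ _ k hk G hG ρ hρ P _ ε δ hε hδ hδ1 m hmC
  set L := Real.log (2 / δ) with hL
  have hL2 : 1 / 2 ≤ L := by
    have h1 : Real.log 2 ≤ L := Real.log_le_log (by norm_num) (by rw [le_div_iff₀ hδ]; linarith)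
    linarith [Real.log_two_gt_d9]
  have hLδ : -Real.log δ ≤ L := by
    rw [hL, Real.log_div (by norm_num) hδ.ne']
    linarith [Real.log_two_gt_d9]
  set D : ℝ := ((max ρ 1 : ℕ) : ℝ) with hD
  have hD1 : 1 ≤ D := by rw [hD]; exact_mod_cast le_max_right ρ 1
  have hk1 : (1 : ℝ) ≤ k := by exact_mod_cast hk
  have hmpos : (0 : ℝ) < m := lt_of_lt_of_le (by positivity) hmC
  have hm : 0 < m := by exact_mod_cast hmpos
  have hmul : 200000 * (D * (k : ℝ) ^ 2 * L) ≤ m * ε ^ 2 := by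
    have h1 : 200000 * (D * (k : ℝ) ^ 2 / ε ^ 2 * L) * ε ^ 2 ≤ m * ε ^ 2 :=
      mul_le_mul_of_nonneg_right hmC (by positivity)
    have h2 : 200000 * (D * (k : ℝ) ^ 2 / ε ^ 2 * L) * ε ^ 2 = 200000 * (D * (k : ℝ) ^ 2 * L) := by
      field_simp
    linarith
  rcases G.eq_empty_or_nonempty with hGe | hGne
  · have h1 : {S : Fin m → V | GraphDiscrimination.deviation G P S ≤ ε} = Set.univ := by
      refine Set.eq_univ_of_forall fun S => ?_
      subst hGe
      simp [GraphDiscrimination.deviation, hε.le]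
    rw [h1]
    simp [hδ.le]
  -- The deviation never exceeds `2`. Below that, `ε ^ 2 ≤ 2 * ε` turns the sample size condition
  -- into `k ^ 2 / m ≤ ε / 4`.
  by_cases hε2 : 2 ≤ ε
  · have h1 : {S : Fin m → V | GraphDiscrimination.deviation G P S ≤ ε} = Set.univ :=
      Set.eq_univ_of_forall fun S =>
        ((le_abs_self _).trans (GraphDiscrimination.abs_deviation_le G P S)).trans hε2
    rw [h1]
    simp [hδ.le]
  push Not at hε2
  set E := ∫ S, GraphDiscrimination.deviation G P S ∂(Measure.pi fun _ : Fin m => P) with hE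
  have hEε : E ≤ ε / 2 := by
    have h1 := GraphDiscrimination.integral_deviation_le hm G hGne hG hρ.le P
    have hsq : 66 * (k * √(D / m)) ≤ ε / 4 := by
      have h2 : √(D / m) ≤ ε / (264 * k) := by
        rw [Real.sqrt_le_left (by positivity), div_pow, div_le_div_iff₀ hmpos (by positivity)]
        have : D * (k : ℝ) ^ 2 * (1 / 2) ≤ D * (k : ℝ) ^ 2 * L := by gcongr
        nlinarith
      calc 66 * (k * √(D / m)) ≤ 66 * (k * (ε / (264 * k))) := by gcongr
        _ = ε / 4 := by field_simp; norm_num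
    have hkm : (k : ℝ) ^ 2 / m ≤ ε / 4 := by
      rw [div_le_iff₀ hmpos]
      have h3 : (k : ℝ) ^ 2 * (1 / 2) ≤ D * (k : ℝ) ^ 2 * L := by
        have : (k : ℝ) ^ 2 ≤ D * (k : ℝ) ^ 2 := le_mul_of_one_le_left (by positivity) hD1
        gcongr
      have h4 : (m : ℝ) * ε ^ 2 ≤ m * (2 * ε) := by
        have : ε ^ 2 ≤ 2 * ε := by nlinarith
        gcongr
      nlinarith [sq_nonneg (k : ℝ)]
    have h5 : (k : ℝ) * (66 * √(D / m)) = 66 * (k * √(D / m)) := by ring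
    linarith
  -- The mean uses half of `ε` and the fluctuation the other half; with differences `k / m` the tail
  -- exponent is `m * ε ^ 2 / (8 * k ^ 2)`.
  have htail := GraphDiscrimination.measureReal_ge_le_of_bounded_diff P hm
    (GraphDiscrimination.deviation G P) (c := k / m) (t := ε / 2)
    (fun S => GraphDiscrimination.abs_deviation_le G P S) (by positivity)
    (fun S i v => GraphDiscrimination.abs_deviation_update_sub_le G P S i v) (by positivity)
  have hexp : Real.exp (-((ε / 2) ^ 2 / (2 * m * (k / m : ℝ) ^ 2))) ≤ δ := by
    rw [← Real.le_log_iff_exp_le hδ]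
    have h1 : (ε / 2) ^ 2 / (2 * m * (k / m : ℝ) ^ 2) = m * ε ^ 2 / (8 * (k : ℝ) ^ 2) := by
      field_simp; norm_num
    have h2 : L ≤ m * ε ^ 2 / (8 * (k : ℝ) ^ 2) := by
      rw [le_div_iff₀ (by positivity)]
      have : (k : ℝ) ^ 2 * L ≤ D * (k : ℝ) ^ 2 * L := by
        rw [mul_assoc]; exact le_mul_of_one_le_left (by positivity) hD1
      nlinarith [show (0 : ℝ) ≤ (k : ℝ) ^ 2 * L by positivity]
    rw [h1]
    linarith
  have hsub : {S : Fin m → V | GraphDiscrimination.deviation G P S ≤ ε}ᶜ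
      ⊆ {S | E + ε / 2 ≤ GraphDiscrimination.deviation G P S} := by
    intro S hS
    have hS' : ε < GraphDiscrimination.deviation G P S := not_le.1 hS
    show E + ε / 2 ≤ GraphDiscrimination.deviation G P S
    linarith
  have hcompl := measureReal_mono (μ := Measure.pi fun _ : Fin m => P) hsub
  rw [probReal_compl_eq_one_sub MeasurableSet.of_discrete] at hcompl
  linarith
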